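/- Let $(M,g)$ be a smooth four-dimensional Lorentzian manifold of signature $(1,3)$, $D$ its Levi-Civita connection, $U\subseteq M$ open, $\{e_a\}_{a=0,\dots,3}$ a smooth orthonormal frame on $U$, $g(e_a,e_b)=\eta_{ab}=\mathrm{diag}(1,-1,-1,-1)$, and $\{\theta^a\}$ the dual coframe. Frame indices are moved with $\eta$ and repeated indices are summed. Let $\star$ be the Hodge star of $g$ and of the volume form $\tau=\theta^0\wedge\theta^1\wedge\theta^2\wedge\theta^3$, so $A\wedge\star B=(A\cdot B)\,\tau$. Let $\omega^a{}_b$ be the connection 1-forms, $D_v e_b=\omega^a{}_b(v)\,e_a$, and $\mathcal R^a{}_b=d\omega^a{}_b+\omega^a{}_c\wedge\omega^c{}_b$ the curvature 2-forms, with $\mathcal R_{ab}=\tfrac12 R_{abcd}\,\theta^c\wedge\theta^d$, Ricci components $R_{ab}=R_a{}^c{}_{bc}$, scalar curvature $R=\eta^{ab}R_{ab}$, Ricci 1-forms $\mathcal R^a=R^a{}_b\theta^b$ and Einstein 1-forms $\mathcal G^a=\mathcal R^a-\tfrac12R\,\theta^a$. Define the superpotential 2-forms $\mathcal S^c$ and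 the pseudo-current 1-forms $\mathfrak t^c$ (both built from the chosen coframe) by $$\star\mathcal S^{c}=\tfrac12\,\omega_{ab}\wedge\star(\theta^a\wedge\theta^b\wedge\theta^c),$$ $$\star\mathfrak t^{c}=-\tfrac12\,\omega_{ab}\wedge\big[\omega^c{}_d\wedge\star(\theta^a\wedge\theta^b\wedge\theta^d)+\omega^b{}_d\wedge\star(\theta^a\wedge\theta^d\wedge\theta^c)\big].$$ Then on $U$ $$\tfrac12\,\mathcal R_{ab}\wedge\star(\theta^a\wedge\theta^b\wedge\theta^c)=-\star\mathcal G^c ,\qquad \star\mathcal G^{a}=-d\star\mathcal S^{a}-\star\mathfrak t^{a}.$$ Consequently, for every covariant 2-tensor field $T$, with $T_{ab}=T(e_a,e_b)$ and $\mathcal T^a=T^a{}_b\theta^b$, Einstein's equations $R_{ab}-\tfrac12\eta_{ab}R=T_{ab}$ hold at a point $x\in U$ if and only if at $x$ $$-d\star\mathcal S^{a}=\star\mathcal T^{a}+\star\mathfrak t^{a}\qquad(a=0,1,2,3).$$ -/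

import Mathlib

open scoped Manifold ContDiff

noncomputable section

namespace Spacetime

/-! ### Pointwise exterior algebra -/

section Algebra

variable {V : Type*} [AddCommGroup V] [Module ℝ V] [TopologicalSpace V]

/-- Tensor product of two alternating forms, as a multilinear map in `p + q` arguments:
`(v₁, …, v_{p+q}) ↦ α(v₁, …, v_p) β(v_{p+1}, …, v_{p+q})`. -/
def tensorMul {p q : ℕ} (α : V [⋀^Fin p]→L[ℝ] ℝ) (β : V [⋀^Fin q]→L[ℝ] ℝ) :
    ContinuousMultilinearMap ℝ (fun _ : Fin (p + q) => V) ℝ where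
  toFun v := α (fun i => v (Fin.castAdd q i)) * β (fun j => v (Fin.natAdd p j))
  map_update_add' := by
    intro inst v i x y
    have hinst : inst = instDecidableEqFin (p + q) := Subsingleton.elim _ _
    subst hinst
    refine Fin.addCases (fun i => ?_) (fun j => ?_) i
    · have h1 : ∀ z : V, (fun k => Function.update v (Fin.castAdd q i) z (Fin.castAdd q k))
          = Function.update (fun k => v (Fin.castAdd q k)) i z := by
        intro z
        exact Function.update_comp_eq_of_injective v (Fin.castAdd_injective p q) i z
      have h2 : ∀ z : V, (fun k => Function.update v (Fin.castAdd q i) z (Fin.natAdd p k))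
          = fun k => v (Fin.natAdd p k) := by
        intro z
        funext k
        refine Function.update_of_ne ?_ _ _
        intro h
        have := congrArg Fin.val h
        simp at this
        omega
      simp only [h1, h2, ContinuousAlternatingMap.map_update_add, add_mul]
    · have h1 : ∀ z : V, (fun k => Function.update v (Fin.natAdd p j) z (Fin.natAdd p k))
          = Function.update (fun k => v (Fin.natAdd p k)) j z := by
        intro z
        exact Function.update_comp_eq_of_injective v (Fin.natAdd_injective q p) j z
      have h2 : ∀ z : V, (fun k => Function.update v (Fin.natAdd p j) z (Fin.castAdd q k))
          = fun k => v (Fin.castAdd q k) := by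
        intro z
        funext k
        refine Function.update_of_ne ?_ _ _
        intro h
        have := congrArg Fin.val h
        simp at this
        omega
      simp only [h1, h2, ContinuousAlternatingMap.map_update_add, mul_add]
  map_update_smul' := by
    intro inst v i c x
    have hinst : inst = instDecidableEqFin (p + q) := Subsingleton.elim _ _
    subst hinst
    refine Fin.addCases (fun i => ?_) (fun j => ?_) i
    · have h1 : ∀ z : V, (fun k => Function.update v (Fin.castAdd q i) z (Fin.castAdd q k))
          = Function.update (fun k => v (Fin.castAdd q k)) i z := by
        intro z
        exact Function.update_comp_eq_of_injective v (Fin.castAdd_injective p q) i z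
      have h2 : ∀ z : V, (fun k => Function.update v (Fin.castAdd q i) z (Fin.natAdd p k))
          = fun k => v (Fin.natAdd p k) := by
        intro z
        funext k
        refine Function.update_of_ne ?_ _ _
        intro h
        have := congrArg Fin.val h
        simp at this
        omega
      simp only [h1, h2, ContinuousAlternatingMap.map_update_smul, smul_eq_mul, mul_assoc]
    · have h1 : ∀ z : V, (fun k => Function.update v (Fin.natAdd p j) z (Fin.natAdd p k))
          = Function.update (fun k => v (Fin.natAdd p k)) j z := by
        intro z
        exact Function.update_comp_eq_of_injective v (Fin.natAdd_injective q p) j z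
      have h2 : ∀ z : V, (fun k => Function.update v (Fin.natAdd p j) z (Fin.castAdd q k))
          = fun k => v (Fin.castAdd q k) := by
        intro z
        funext k
        refine Function.update_of_ne ?_ _ _
        intro h
        have := congrArg Fin.val h
        simp at this
        omega
      simp only [h1, h2, ContinuousAlternatingMap.map_update_smul, smul_eq_mul, mul_left_comm]
  cont := by
    refine Continuous.mul (α.cont.comp ?_) (β.cont.comp ?_) <;> fun_prop

/-- Exterior product, `(α ∧ β)(v) = 1/(p! q!) ∑_σ sign σ α(v_σ(1), …) β(v_σ(p+1), …)`;
for `1`-forms `(α ∧ β)(u, v) = α u * β v - α v * β u`. -/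
def wedge {p q : ℕ} (α : V [⋀^Fin p]→L[ℝ] ℝ) (β : V [⋀^Fin q]→L[ℝ] ℝ) :
    V [⋀^Fin (p + q)]→L[ℝ] ℝ :=
  ((p.factorial * q.factorial : ℝ)⁻¹) •
    ContinuousMultilinearMap.alternatization (tensorMul α β)

/-- A covector seen as a `1`-form. -/
def oneForm (α : V →L[ℝ] ℝ) : V [⋀^Fin 1]→L[ℝ] ℝ :=
  ContinuousAlternatingMap.ofSubsingleton ℝ V ℝ (0 : Fin 1) α

/-- Contraction of the first `k` arguments: `v ↦ τ(w₁, …, w_k, v₁, …, v_m)`. -/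
def contractFirst {k m n : ℕ} (h : k + m = n) (τ : V [⋀^Fin n]→L[ℝ] ℝ) (w : Fin k → V) :
    V [⋀^Fin m]→L[ℝ] ℝ where
  toFun v := τ (fun i => Fin.append w v (Fin.cast h.symm i))
  map_update_add' := by
    intro inst v i x y
    have hinst : inst = instDecidableEqFin m := Subsingleton.elim _ _
    subst hinst
    subst h
    have h1 : ∀ z : V, (fun k' => Fin.append w (Function.update v i z) (Fin.cast rfl k'))
        = Function.update (Fin.append w v) (Fin.natAdd k i) z := by
      intro z
      funext k'
      refine Fin.addCases (fun a => ?_) (fun b => ?_) k'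
      · have : Fin.castAdd m a ≠ Fin.natAdd k i := by
          intro h
          have := congrArg Fin.val h
          simp at this
          omega
        simp [Function.update_of_ne this]
      · by_cases hb : b = i
        · subst hb
          simp
        · have : Fin.natAdd k b ≠ Fin.natAdd k i := fun h =>
            hb (Fin.natAdd_injective m k h)
          simp [Function.update_of_ne this, Function.update_of_ne hb]
    simp only [h1, ContinuousAlternatingMap.map_update_add]
  map_update_smul' := by
    intro inst v i c x
    have hinst : inst = instDecidableEqFin m := Subsingleton.elim _ _
    subst hinst
    subst h
    have h1 : ∀ z : V, (fun k' => Fin.append w (Function.update v i z) (Fin.cast rfl k'))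
        = Function.update (Fin.append w v) (Fin.natAdd k i) z := by
      intro z
      funext k'
      refine Fin.addCases (fun a => ?_) (fun b => ?_) k'
      · have : Fin.castAdd m a ≠ Fin.natAdd k i := by
          intro h
          have := congrArg Fin.val h
          simp at this
          omega
        simp [Function.update_of_ne this]
      · by_cases hb : b = i
        · subst hb
          simp
        · have : Fin.natAdd k b ≠ Fin.natAdd k i := fun h =>
            hb (Fin.natAdd_injective m k h)
          simp [Function.update_of_ne this, Function.update_of_ne hb]
    simp only [h1, ContinuousAlternatingMap.map_update_smul]
  cont := by
    subst h
    refine τ.cont.comp (continuous_pi fun i => ?_)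
    refine Fin.addCases (fun a => ?_) (fun b => ?_) i
    · simpa using continuous_const
    · simpa using continuous_apply b
  map_eq_zero_of_eq' := by
    intro v i j hv hij
    subst h
    refine τ.map_eq_zero_of_eq _ (i := Fin.natAdd k i) (j := Fin.natAdd k j) ?_ ?_
    · simpa using hv
    · exact fun h => hij (Fin.natAdd_injective m k h)

/-- Diagonal entries of the Minkowski matrix `η = diag(1, -1, -1, -1)`. Since `η` is diagonal
and `η⁻¹ = η`, a frame index `a` is raised or lowered by multiplying with `eta a`. -/
def eta (a : Fin 4) : ℝ := if a = 0 then 1 else -1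

/-- Hodge dual of a `k`-form with respect to an orthonormal basis `e` (so `g(e_a, e_b) = η_ab`) and
a volume form `τ` with `τ(e₀, e₁, e₂, e₃) = 1`:
`(⋆A)(v) = (1/k!) ∑_{i₁, …, i_k} A^{i₁…i_k} τ(e_{i₁}, …, e_{i_k}, v₁, …, v_{4-k})`.
It is characterised by `B ∧ ⋆A = (B · A) τ` for all `k`-forms `B`, where `·` is the scalar product
with `(a₁ ∧ … ∧ a_k) · (b₁ ∧ … ∧ b_k) = det (g⁻¹(a_i, b_j))`. -/
def hodgeStar [IsTopologicalAddGroup V] {k m : ℕ} (h : k + m = 4) (e : Fin 4 → V)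
    (τ : V [⋀^Fin 4]→L[ℝ] ℝ) (A : V [⋀^Fin k]→L[ℝ] ℝ) : V [⋀^Fin m]→L[ℝ] ℝ :=
  ((k.factorial : ℝ)⁻¹) • ∑ i : Fin k → Fin 4,
    ((∏ j, eta (i j)) * A (fun j => e (i j))) • contractFirst h τ (fun j => e (i j))

end Algebra

/-! ### Four-dimensional Lorentzian manifolds -/

section Manifold

/-- The model space `ℝ⁴`. -/
abbrev R4 : Type := EuclideanSpace ℝ (Fin 4)

variable (M : Type*) [TopologicalSpace M] [ChartedSpace R4 M]

/-- (Not necessarily smooth) fields of `k`-forms on `M`. -/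
abbrev FormField (k : ℕ) : Type _ := (x : M) → TangentSpace (𝓡 4) x [⋀^Fin k]→L[ℝ] ℝ

/-- Fields of covariant two-tensors on `M`. -/
abbrev TwoTensor : Type _ :=
  (x : M) → TangentSpace (𝓡 4) x →L[ℝ] TangentSpace (𝓡 4) x →L[ℝ] ℝ

variable {M}

/-- Exterior derivative of a field of forms: at `x` it is computed in the preferred chart `φ` at
`x`, as `φ^* d ((φ⁻¹)^* α)`. -/
def extD {k : ℕ} (α : FormField M k) : FormField M (k + 1) := fun x =>
  (extDeriv
    (fun y : R4 => (α ((extChartAt (𝓡 4) x).symm y)).compContinuousLinearMap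
      (mfderiv 𝓘(ℝ, R4) (𝓡 4) (extChartAt (𝓡 4) x).symm y) : R4 → R4 [⋀^Fin k]→L[ℝ] ℝ)
    (extChartAt (𝓡 4) x x)).compContinuousLinearMap
      (mfderiv (𝓡 4) 𝓘(ℝ, R4) (extChartAt (𝓡 4) x) x)

variable (M) in
/-- A smooth Lorentzian metric of signature `(1, 3)` on `M`. -/
structure LorentzianMetric [IsManifold (𝓡 4) ∞ M] where
  val : TwoTensor M
  symm : ∀ x v w, val x v w = val x w v
  smooth : ContMDiff (𝓡 4) ((𝓡 4).prod 𝓘(ℝ, R4 →L[ℝ] R4 →L[ℝ] ℝ)) ∞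
    (fun x => Bundle.TotalSpace.mk' (R4 →L[ℝ] R4 →L[ℝ] ℝ) x (val x))
  signature : ∀ x, ∃ b : Module.Basis (Fin 4) ℝ (TangentSpace (𝓡 4) x),
    ∀ i j, val x (b i) (b j) = if i = j then eta i else 0

variable [IsManifold (𝓡 4) ∞ M]

/-- A linear connection (Koszul connection on `TM`); `D Y x v` is `D_v Y` at `x`. -/
abbrev LinearConnection (M : Type*) [TopologicalSpace M] [ChartedSpace R4 M]
    [IsManifold (𝓡 4) ∞ M] : Type _ :=
  CovariantDerivative (𝓡 4) R4 (TangentSpace (𝓡 4) : M → Type _)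

/-- `D` is the Levi-Civita connection of `g`: it is metric compatible, `D g = 0`, and its torsion
vanishes. -/
structure IsLeviCivita (g : LorentzianMetric M) (D : LinearConnection M) : Prop where
  metric : ∀ (x : M) (Y Z : (y : M) → TangentSpace (𝓡 4) y),
    MDifferentiableAt (𝓡 4) ((𝓡 4).prod 𝓘(ℝ, R4)) (fun y => Bundle.TotalSpace.mk' R4 y (Y y)) x →
    MDifferentiableAt (𝓡 4) ((𝓡 4).prod 𝓘(ℝ, R4)) (fun y => Bundle.TotalSpace.mk' R4 y (Z y)) x →
    ∀ v : TangentSpace (𝓡 4) x,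
      mvfderiv (𝓡 4) (fun y => g.val y (Y y) (Z y)) x v =
        g.val x (D Y x v) (Z x) + g.val x (Y x) (D Z x v)
  torsion_eq_zero : D.torsion = 0

/-- A smooth orthonormal frame `e_a` on `U` (`g(e_a, e_b) = η_ab`) with its dual coframe `θ^a`
(`θ^a(e_b) = δ^a_b`). Values outside `U` are irrelevant. -/
structure OrthonormalTetrad (g : LorentzianMetric M) (U : Set M) where
  e : Fin 4 → (x : M) → TangentSpace (𝓡 4) x
  θ : Fin 4 → (x : M) → TangentSpace (𝓡 4) x →L[ℝ] ℝ
  smooth_e : ∀ a, ContMDiffOn (𝓡 4) ((𝓡 4).prod 𝓘(ℝ, R4)) ∞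
    (fun x => Bundle.TotalSpace.mk' R4 x (e a x)) U
  smooth_θ : ∀ a, ContMDiffOn (𝓡 4) ((𝓡 4).prod 𝓘(ℝ, R4 →L[ℝ] ℝ)) ∞
    (fun x => Bundle.TotalSpace.mk' (R4 →L[ℝ] ℝ) x (θ a x)) U
  orthonormal : ∀ x ∈ U, ∀ a b, g.val x (e a x) (e b x) = if a = b then eta a else 0
  dual : ∀ x ∈ U, ∀ a b, θ a x (e b x) = if a = b then 1 else 0

namespace OrthonormalTetrad

variable {g : LorentzianMetric M} {U : Set M} (t : OrthonormalTetrad g U)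

/-- The coframe `θ^a` as `1`-forms. -/
def coframe (a : Fin 4) : FormField M 1 := fun x => oneForm (t.θ a x)

/-- The volume form `θ⁰ ∧ θ¹ ∧ θ² ∧ θ³` of the orientation in which the coframe is positive. -/
def vol : FormField M 4 := fun x =>
  wedge (wedge (wedge (t.coframe 0 x) (t.coframe 1 x)) (t.coframe 2 x)) (t.coframe 3 x)

/-- The Hodge star operator on fields of `k`-forms. -/
def star {k m : ℕ} (h : k + m = 4) (A : FormField M k) : FormField M m := fun x =>
  hodgeStar h (fun a => t.e a x) (t.vol x) (A x)

/-- The `1`-form `⋆(θ^a ∧ θ^b ∧ θ^c)`. -/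
def starθ (a b c : Fin 4) : FormField M 1 :=
  t.star (k := 3) (m := 1) rfl
    (fun x => wedge (wedge (t.coframe a x) (t.coframe b x)) (t.coframe c x))

variable (D : LinearConnection M)

/-- Connection `1`-forms `ω^a_b`, defined by `D_v e_b = ω^a_b(v) e_a`. -/
def conn (a b : Fin 4) : FormField M 1 := fun x => oneForm ((t.θ a x).comp (D (t.e b) x))

/-- Connection `1`-forms with lowered index, `ω_ab = η_ac ω^c_b`. -/
def connLow (a b : Fin 4) : FormField M 1 := fun x => eta a • t.conn D a b x

/-- Curvature `2`-forms `ℛ^a_b = dω^a_b + ω^a_c ∧ ω^c_b`. -/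
def curv (a b : Fin 4) : FormField M 2 := fun x =>
  extD (t.conn D a b) x + ∑ c, wedge (t.conn D a c x) (t.conn D c b x)

/-- Curvature `2`-forms with lowered index, `ℛ_ab = η_ac ℛ^c_b`. -/
def curvLow (a b : Fin 4) : FormField M 2 := fun x => eta a • t.curv D a b x

/-- Components `R_abcd` of the curvature tensor, `ℛ_ab = ½ R_abcd θ^c ∧ θ^d`. -/
def riemann (a b c d : Fin 4) (x : M) : ℝ := t.curvLow D a b x ![t.e c x, t.e d x]

/-- Components of the Ricci tensor, `R_ab = R_a^c_bc`. -/
def ricci (a b : Fin 4) (x : M) : ℝ := ∑ c, eta c * t.riemann D a c b c x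

/-- Scalar curvature, `R = η^ab R_ab`. -/
def scalar (x : M) : ℝ := ∑ a, eta a * t.ricci D a a x

/-- Ricci `1`-forms `ℛ^a = R^a_b θ^b`. -/
def ricciForm (a : Fin 4) : FormField M 1 := fun x =>
  ∑ b, (eta a * t.ricci D a b x) • t.coframe b x

/-- Einstein `1`-forms `𝒢^a = ℛ^a - ½ R θ^a`. -/
def einsteinForm (a : Fin 4) : FormField M 1 := fun x =>
  t.ricciForm D a x - (1 / 2 * t.scalar D x) • t.coframe a x

/-- Components `T_ab = T(e_a, e_b)` of a two-tensor. -/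
def comp (T : TwoTensor M) (a b : Fin 4) (x : M) : ℝ := T x (t.e a x) (t.e b x)

/-- Energy-momentum `1`-forms `𝒯^a = T^a_b θ^b` of the energy-momentum tensor `T`. -/
def energyForm (T : TwoTensor M) (a : Fin 4) : FormField M 1 := fun x =>
  ∑ b, (eta a * t.comp T a b x) • t.coframe b x

/-- Einstein's equations `R_ab - ½ η_ab R = T_ab` at the point `x`. -/
def EinsteinEqAt (T : TwoTensor M) (x : M) : Prop :=
  ∀ a b, t.ricci D a b x - 1 / 2 * (if a = b then eta a else 0) * t.scalar D x = t.comp T a b x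

/-- The superpotential `2`-forms `𝒮^c`, with `⋆𝒮^c = ½ ω_ab ∧ ⋆(θ^a ∧ θ^b ∧ θ^c)`
(on `2`-forms `⋆⋆ = -1`). -/
def superpotential (c : Fin 4) : FormField M 2 :=
  -t.star (k := 2) (m := 2) rfl (fun x => (1 / 2 : ℝ) • ∑ a, ∑ b,
      wedge (t.connLow D a b x) (t.starθ a b c x))

/-- The pseudo-current `1`-forms `𝔱^c`, with
`⋆𝔱^c = -½ ω_ab ∧ [ω^c_d ∧ ⋆(θ^a ∧ θ^b ∧ θ^d) + ω^b_d ∧ ⋆(θ^a ∧ θ^d ∧ θ^c)]`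
(on `3`-forms `⋆⋆ = 1`). -/
def pseudoCurrent (c : Fin 4) : FormField M 1 :=
  t.star (k := 3) (m := 1) rfl (fun x => (-(1 / 2) : ℝ) • ∑ a, ∑ b,
      wedge (t.connLow D a b x) (∑ d, (wedge (t.conn D c d x) (t.starθ a b d x) +
        wedge (t.conn D b d x) (t.starθ a d c x))))

end OrthonormalTetrad

end Manifold

end Spacetime

end

open Spacetime

/-!
The identity is local, so it is proved at one point `x` after pulling everything back along the
inverse of the preferred chart at `x`; there `extD` is the exterior derivative of `ℝ⁴`.

*Structure equations.* Metric compatibility makes the connection forms antisymmetric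
(`connLow_antisymm`). Vanishing torsion says
`θ^a([e_b, e_c]) = ω^a_c(e_b) - ω^a_b(e_c)` (`chartCoframe_lieBracket`). Together they give Koszul's
formula for `ω`, so the connection forms are differentiable (`differentiableAt_connection`);
vanishing torsion alone gives Cartan's equation `dθ^a = -ω^a_b ∧ θ^b` (`extDeriv_coframe`), and
`ddθ^a = 0` then gives the first Bianchi identity `ℛ^a_b ∧ θ^b = 0` (`first_bianchi`).

*The Einstein forms.* The first Bianchi identity and the antisymmetry of `ℛ_ab` imply the pair
symmetry of the curvature components. Since `⋆(θ^a ∧ θ^b ∧ θ^c) = ε^{abc}_d θ^d`,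
contracting with the Levi-Civita symbol turns `½ ℛ_ab ∧ ⋆(θ^a ∧ θ^b ∧ θ^c)` into `-⋆𝒢^c`
(`einstein_comp`, `einstein_form`).

*The superpotential.* Put `⋆θ^{abc} = ⋆(θ^a ∧ θ^b ∧ θ^c)`. The Leibniz rule splits `d⋆𝒮^c` into
`½ dω_ab ∧ ⋆θ^{abc}` and `-½ ω_ab ∧ d⋆θ^{abc}`. As `ω` takes values in the Lorentz algebra, which
preserves `ε` (`starComp_invariant`), the form `-d⋆θ^{abc}` is the sum of the terms in
which `ω` acts on one of the indices `a`, `b`, `c` (`sum_starComp_wedge`). In `d⋆𝒮^c` the action on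
`a` supplies the quadratic part of the curvature, and the other two terms add up to `-⋆𝔱^c`; hence
`½ ℛ_ab ∧ ⋆θ^{abc} = d⋆𝒮^c + ⋆𝔱^c` (`superpotential_algebra`, `superpotential_identity`).

Einstein's equations then become the asserted field equations because `⋆` is injective on `1`-forms
and a `1`-form is determined by its values on the frame (`hodgeStar_one_injective`,
`einsteinEqAt_iff`).
-/

noncomputable section

namespace Spacetime

open Filter Topology

/-! ### Evaluation of exterior products of low degree -/

section PermutationSums

open Equiv

lemma sum_perm_succ {n : ℕ} (f : Perm (Fin (n + 1)) → ℝ) :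
    ∑ σ, f σ = ∑ p, ∑ e : Perm (Fin n), f (Perm.decomposeFin.symm (p, e)) := by
  rw [← Fintype.sum_prod_type' (f := fun p e => f (Perm.decomposeFin.symm (p, e)))]
  exact (Equiv.sum_comp Perm.decomposeFin.symm f).symm

lemma sum_perm_two (F : Fin 2 → Fin 2 → ℝ) :
    ∑ σ : Perm (Fin 2), (Perm.sign σ : ℝ) * F (σ 0) (σ 1) = F 0 1 - F 1 0 := by
  simp [sum_perm_succ, Fin.sum_univ_succ, Perm.decomposeFin_symm_apply_one]
  ring

lemma sum_perm_three (F : Fin 3 → Fin 3 → Fin 3 → ℝ) :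
    ∑ σ : Perm (Fin 3), (Perm.sign σ : ℝ) * F (σ 0) (σ 1) (σ 2) =
      F 0 1 2 - F 0 2 1 - F 1 0 2 + F 1 2 0 + F 2 0 1 - F 2 1 0 := by
  have h : (Finset.univ : Finset (Perm (Fin 3))) =
      {1, swap 1 2, swap 0 1, swap 0 1 * swap 1 2, swap 1 2 * swap 0 1, swap 0 2} := by decide
  rw [h]
  repeat rw [Finset.sum_insert (by decide)]
  rw [Finset.sum_singleton]
  simp [Equiv.swap_apply_def]
  ring

/-- Sum over the permutations of four letters, split according to the image `p` of `0`. -/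
lemma sum_perm_four (F : Fin 4 → Fin 4 → Fin 4 → Fin 4 → ℝ) :
    ∑ σ : Perm (Fin 4), (Perm.sign σ : ℝ) * F (σ 0) (σ 1) (σ 2) (σ 3) =
      ∑ p : Fin 4, (if p = 0 then 1 else -1 : ℝ) * ∑ e : Perm (Fin 3), (Perm.sign e : ℝ) *
        F p (swap 0 p (e 0).succ) (swap 0 p (e 1).succ) (swap 0 p (e 2).succ) := by
  rw [sum_perm_succ]
  refine Finset.sum_congr rfl fun p _ => ?_
  rw [Finset.mul_sum]
  refine Finset.sum_congr rfl fun e _ => ?_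
  rw [Perm.decomposeFin.symm_sign, ← mul_assoc]
  congr 1
  · split_ifs <;> simp
  · have hs := fun i => Perm.decomposeFin_symm_apply_succ e p i
    rw [Perm.decomposeFin_symm_apply_zero]
    exact congr (congr (congrArg (F p) (hs 0)) (hs 1)) (hs 2)

end PermutationSums

lemma vec_one {X : Type*} (f : Fin 1 → X) : f = ![f 0] := by
  ext i; fin_cases i; rfl

lemma vec_two {X : Type*} (f : Fin 2 → X) : f = ![f 0, f 1] := by
  ext i; fin_cases i <;> rfl

lemma vec_three {X : Type*} (f : Fin 3 → X) : f = ![f 0, f 1, f 2] := by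
  ext i; fin_cases i <;> rfl

section Evaluation

variable {V : Type*} [AddCommGroup V] [Module ℝ V] [TopologicalSpace V]

lemma alt_two_swap (A : V [⋀^Fin 2]→L[ℝ] ℝ) (u v : V) : A ![v, u] = -A ![u, v] := by
  have := A.toAlternatingMap.map_swap ![u, v] (i := 0) (j := 1) (by decide)
  rw [show ![u, v] ∘ Equiv.swap (0 : Fin 2) 1 = ![v, u] by ext i; fin_cases i <;> rfl] at this
  exact this

lemma alt_three_swap (A : V [⋀^Fin 3]→L[ℝ] ℝ) (u v w : V) : A ![v, u, w] = -A ![u, v, w] := by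
  have := A.toAlternatingMap.map_swap ![u, v, w] (i := 0) (j := 1) (by decide)
  rw [show ![u, v, w] ∘ Equiv.swap (0 : Fin 3) 1 = ![v, u, w] by
    ext i; fin_cases i <;> rfl] at this
  exact this

lemma alt_three_swap' (A : V [⋀^Fin 3]→L[ℝ] ℝ) (u v w : V) : A ![u, w, v] = -A ![u, v, w] := by
  have := A.toAlternatingMap.map_swap ![u, v, w] (i := 1) (j := 2) (by decide)
  rw [show ![u, v, w] ∘ Equiv.swap (1 : Fin 3) 2 = ![u, w, v] by
    ext i; fin_cases i <;> rfl] at this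
  exact this

lemma wedge_apply {p q : ℕ} (α : V [⋀^Fin p]→L[ℝ] ℝ) (β : V [⋀^Fin q]→L[ℝ] ℝ)
    (v : Fin (p + q) → V) :
    wedge α β v = (p.factorial * q.factorial : ℝ)⁻¹ * ∑ σ : Equiv.Perm (Fin (p + q)),
      (Equiv.Perm.sign σ : ℝ) * (α (fun i => v (σ (Fin.castAdd q i))) *
        β (fun j => v (σ (Fin.natAdd p j)))) := by
  simp only [wedge, ContinuousAlternatingMap.smul_apply, smul_eq_mul,
    ContinuousMultilinearMap.alternatization_apply_apply]
  congr 1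
  refine Finset.sum_congr rfl fun σ _ => ?_
  rw [Units.smul_def, zsmul_eq_mul]
  rfl

lemma oneForm_apply (α : V →L[ℝ] ℝ) (v : Fin 1 → V) : oneForm α v = α (v 0) := rfl

lemma wedge_one_one (α β : V [⋀^Fin 1]→L[ℝ] ℝ) (v : Fin 2 → V) :
    wedge α β v = α ![v 0] * β ![v 1] - α ![v 1] * β ![v 0] := by
  have h := wedge_apply α β v
  have h2 : ∀ σ : Equiv.Perm (Fin 2), α (fun i => v (σ (Fin.castAdd 1 i))) *
        β (fun j => v (σ (Fin.natAdd 1 j))) = α ![v (σ 0)] * β ![v (σ 1)] := fun σ => by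
    rw [vec_one (fun i => v (σ (Fin.castAdd 1 i))), vec_one (fun j => v (σ (Fin.natAdd 1 j)))]; rfl
  simp only [h2] at h
  rw [h, sum_perm_two (fun i j => α ![v i] * β ![v j])]
  simp

lemma wedge_two_one (A : V [⋀^Fin 2]→L[ℝ] ℝ) (β : V [⋀^Fin 1]→L[ℝ] ℝ) (v : Fin 3 → V) :
    wedge A β v =
      A ![v 0, v 1] * β ![v 2] - A ![v 0, v 2] * β ![v 1] + A ![v 1, v 2] * β ![v 0] := by
  have h := wedge_apply A β v
  have h2 : ∀ σ : Equiv.Perm (Fin 3), A (fun i => v (σ (Fin.castAdd 1 i))) *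
        β (fun j => v (σ (Fin.natAdd 2 j))) = A ![v (σ 0), v (σ 1)] * β ![v (σ 2)] := fun σ => by
    rw [vec_two (fun i => v (σ (Fin.castAdd 1 i))), vec_one (fun j => v (σ (Fin.natAdd 2 j)))]; rfl
  simp only [h2] at h
  rw [h, sum_perm_three (fun i j k => A ![v i, v j] * β ![v k])]
  rw [alt_two_swap A (v 0) (v 1), alt_two_swap A (v 0) (v 2), alt_two_swap A (v 1) (v 2)]
  simp only [Nat.factorial]
  norm_num
  ring

lemma wedge_one_two (α : V [⋀^Fin 1]→L[ℝ] ℝ) (B : V [⋀^Fin 2]→L[ℝ] ℝ) (v : Fin 3 → V) :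
    wedge α B v =
      α ![v 0] * B ![v 1, v 2] - α ![v 1] * B ![v 0, v 2] + α ![v 2] * B ![v 0, v 1] := by
  have h := wedge_apply α B v
  have h2 : ∀ σ : Equiv.Perm (Fin 3), α (fun i => v (σ (Fin.castAdd 2 i))) *
        B (fun j => v (σ (Fin.natAdd 1 j))) = α ![v (σ 0)] * B ![v (σ 1), v (σ 2)] := fun σ => by
    rw [vec_one (fun i => v (σ (Fin.castAdd 2 i))), vec_two (fun j => v (σ (Fin.natAdd 1 j)))]; rfl
  simp only [h2] at h
  erw [h, sum_perm_three (fun i j k => α ![v i] * B ![v j, v k])]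
  rw [alt_two_swap B (v 0) (v 1), alt_two_swap B (v 0) (v 2), alt_two_swap B (v 1) (v 2)]
  simp only [Nat.factorial]
  norm_num
  ring

lemma wedge_three_one (A : V [⋀^Fin 3]→L[ℝ] ℝ) (β : V [⋀^Fin 1]→L[ℝ] ℝ) (v : Fin 4 → V) :
    wedge A β v =
      A ![v 0, v 1, v 2] * β ![v 3] - A ![v 0, v 1, v 3] * β ![v 2] +
        A ![v 0, v 2, v 3] * β ![v 1] - A ![v 1, v 2, v 3] * β ![v 0] := by
  have h := wedge_apply A β v
  have h2 : ∀ σ : Equiv.Perm (Fin 4), A (fun i => v (σ (Fin.castAdd 1 i))) *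
        β (fun j => v (σ (Fin.natAdd 3 j))) =
        A ![v (σ 0), v (σ 1), v (σ 2)] * β ![v (σ 3)] := fun σ => by
    rw [vec_three (fun i => v (σ (Fin.castAdd 1 i))),
      vec_one (fun j => v (σ (Fin.natAdd 3 j)))]; rfl
  simp only [h2] at h
  have h3 : ∀ u v w : V, A ![w, v, u] = -A ![u, v, w] := fun u v w => by
    rw [alt_three_swap A v w u, alt_three_swap' A v u w, alt_three_swap A u v w]; ring
  have h4 : ∀ u v w : V, A ![v, w, u] = A ![u, v, w] := fun u v w => by
    rw [alt_three_swap' A v u w, alt_three_swap A u v w]; ring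
  have h5 : ∀ u v w : V, A ![w, u, v] = A ![u, v, w] := fun u v w => by
    rw [alt_three_swap A u w v, alt_three_swap' A u v w]; ring
  rw [h, sum_perm_four (fun i j k l => A ![v i, v j, v k] * β ![v l])]
  simp only [fun p => sum_perm_three (fun i j k => A ![v p, v (Equiv.swap 0 p i.succ),
    v (Equiv.swap 0 p j.succ)] * β ![v (Equiv.swap 0 p k.succ)])]
  simp [Fin.sum_univ_four, Equiv.swap_apply_def, Nat.factorial]
  simp [alt_three_swap A (v 0) (v 1), alt_three_swap A (v 0) (v 2), alt_three_swap A (v 0) (v 3),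
    alt_three_swap A (v 1) (v 2), alt_three_swap A (v 1) (v 3), alt_three_swap A (v 2) (v 3),
    alt_three_swap' A _ (v 0) (v 2), alt_three_swap' A _ (v 0) (v 3),
    alt_three_swap' A _ (v 1) (v 2), alt_three_swap' A _ (v 1) (v 3),
    alt_three_swap' A _ (v 2) (v 3)]
  ring

end Evaluation

/-! ### The Levi-Civita symbol and curvature-like arrays -/

section LeviCivitaSymbol

/-- The Levi-Civita symbol with `epsilon 0 1 2 3 = 1`, written as a normalised Vandermonde product
of the indices. -/
def epsilon (i j k l : Fin 4) : ℝ :=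
  ((((j - i : ℤ) * (k - i) * (l - i) * (k - j) * (l - j) * (l - k)) / 12 : ℤ) : ℝ)

/-- Components of `⋆(θ^a ∧ θ^b ∧ θ^c)` in the coframe `θ^d`: the Levi-Civita symbol with its first
three indices raised. -/
def starComp (a b c d : Fin 4) : ℝ := eta a * eta b * eta c * epsilon a b c d

/-- The generalised Kronecker delta, in the shape in which `wedge_three_one`, `wedge_two_one` and
`wedge_one_one` expand `θ⁰ ∧ θ¹ ∧ θ² ∧ θ³` on four frame vectors, is the Levi-Civita symbol. -/
lemma epsilon_eq_sum_delta (i j k l : Fin 4) (d : Fin 4 → Fin 4 → ℝ)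
    (hd : ∀ a b, d a b = if a = b then 1 else 0) :
    ((d 0 i * d 1 j - d 0 j * d 1 i) * d 2 k - (d 0 i * d 1 k - d 0 k * d 1 i) * d 2 j +
        (d 0 j * d 1 k - d 0 k * d 1 j) * d 2 i) * d 3 l -
      ((d 0 i * d 1 j - d 0 j * d 1 i) * d 2 l - (d 0 i * d 1 l - d 0 l * d 1 i) * d 2 j +
        (d 0 j * d 1 l - d 0 l * d 1 j) * d 2 i) * d 3 k +
      ((d 0 i * d 1 k - d 0 k * d 1 i) * d 2 l - (d 0 i * d 1 l - d 0 l * d 1 i) * d 2 k +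
        (d 0 k * d 1 l - d 0 l * d 1 k) * d 2 i) * d 3 j -
      ((d 0 j * d 1 k - d 0 k * d 1 j) * d 2 l - (d 0 j * d 1 l - d 0 l * d 1 j) * d 2 k +
        (d 0 k * d 1 l - d 0 l * d 1 k) * d 2 j) * d 3 i = epsilon i j k l := by
  have key : ∀ i j k l : Fin 4, ∀ D : Fin 4 → Fin 4 → ℤ, D = (fun a b => if a = b then 1 else 0) →
    ((D 0 i * D 1 j - D 0 j * D 1 i) * D 2 k - (D 0 i * D 1 k - D 0 k * D 1 i) * D 2 j +
        (D 0 j * D 1 k - D 0 k * D 1 j) * D 2 i) * D 3 l -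
      ((D 0 i * D 1 j - D 0 j * D 1 i) * D 2 l - (D 0 i * D 1 l - D 0 l * D 1 i) * D 2 j +
        (D 0 j * D 1 l - D 0 l * D 1 j) * D 2 i) * D 3 k +
      ((D 0 i * D 1 k - D 0 k * D 1 i) * D 2 l - (D 0 i * D 1 l - D 0 l * D 1 i) * D 2 k +
        (D 0 k * D 1 l - D 0 l * D 1 k) * D 2 i) * D 3 j -
      ((D 0 j * D 1 k - D 0 k * D 1 j) * D 2 l - (D 0 j * D 1 l - D 0 l * D 1 j) * D 2 k +
        (D 0 k * D 1 l - D 0 l * D 1 k) * D 2 j) * D 3 i =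
      ((j - i : ℤ) * (k - i) * (l - i) * (k - j) * (l - j) * (l - k)) / 12 := by
    rintro i j k l D rfl
    revert i j k l
    decide +kernel
  have := key i j k l _ rfl
  rw [epsilon, ← this]
  have hd' : ∀ a b, d a b = (((if a = b then 1 else 0 : ℤ)) : ℝ) := fun a b => by
    rw [hd]; split_ifs <;> simp
  simp only [hd']
  push_cast
  ring

/-- A totally antisymmetric array in three indices vanishes if it does so on increasing triples. -/
lemma antisymm_three_eq_zero (a : Fin 4 → Fin 4 → Fin 4 → ℝ)
    (h1 : ∀ i j k, a j i k = -a i j k) (h2 : ∀ i j k, a i k j = -a i j k)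
    (h012 : a 0 1 2 = 0) (h013 : a 0 1 3 = 0) (h023 : a 0 2 3 = 0) (h123 : a 1 2 3 = 0)
    (i j k : Fin 4) : a i j k = 0 := by
  have z1 : ∀ i k, a i i k = 0 := fun i k => by linarith [h1 i i k]
  have z2 : ∀ i k, a i k k = 0 := fun i k => by linarith [h2 i k k]
  have z3 : ∀ i k, a i k i = 0 := fun i k => by rw [h1, z2, neg_zero]
  fin_cases i <;> fin_cases j <;> fin_cases k <;>
    simp [z1, z2, z3, h012, h013, h023, h123, h1 0 1, h1 0 2, h1 0 3, h1 1 2, h1 1 3, h1 2 3,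
      h2 _ 0 2, h2 _ 0 3, h2 _ 1 2, h2 _ 1 3, h2 _ 2 3]

lemma epsilon_swap_left (i j k l : Fin 4) : epsilon j i k l = -epsilon i j k l := by
  have key : ∀ i j k l : Fin 4,
      ((i - j : ℤ) * (k - j) * (l - j) * (k - i) * (l - i) * (l - k)) / 12 =
      -(((j - i : ℤ) * (k - i) * (l - i) * (k - j) * (l - j) * (l - k)) / 12) := by decide +kernel
  rw [epsilon, key]
  simp [epsilon]

lemma epsilon_swap_right (i j k l : Fin 4) : epsilon i k j l = -epsilon i j k l := by
  have key : ∀ i j k l : Fin 4,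
      ((k - i : ℤ) * (j - i) * (l - i) * (j - k) * (l - k) * (l - j)) / 12 =
      -(((j - i : ℤ) * (k - i) * (l - i) * (k - j) * (l - j) * (l - k)) / 12) := by decide +kernel
  rw [epsilon, key]
  simp [epsilon]

lemma epsilon_swap_last (i j k l : Fin 4) : epsilon i j l k = -epsilon i j k l := by
  have key : ∀ i j k l : Fin 4,
      ((j - i : ℤ) * (l - i) * (k - i) * (l - j) * (k - j) * (k - l)) / 12 =
      -(((j - i : ℤ) * (k - i) * (l - i) * (k - j) * (l - j) * (l - k)) / 12) := by decide +kernel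
  rw [epsilon, key]
  simp [epsilon]

/-- The Levi-Civita symbol is invariant under the Lorentz algebra. -/
lemma starComp_invariant (w : Fin 4 → Fin 4 → ℝ) (hw : ∀ a b, eta a * w a b = -(eta b * w b a))
    (a b c m : Fin 4) :
    ∑ d, starComp a b c d * w d m =
      ∑ d, (w a d * starComp d b c m + w b d * starComp a d c m + w c d * starComp a b d m) := by
  have s1 : ∀ i j k l, starComp j i k l = -starComp i j k l := fun i j k l => by
    rw [starComp, epsilon_swap_left, starComp]
    ring
  have s2 : ∀ i j k l, starComp i k j l = -starComp i j k l := fun i j k l => by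
    rw [starComp, epsilon_swap_right, starComp]
    ring
  have h00 := hw 0 0
  have h11 := hw 1 1
  have h22 := hw 2 2
  have h33 := hw 3 3
  have h01 := hw 0 1
  have h02 := hw 0 2
  have h03 := hw 0 3
  have h12 := hw 1 2
  have h13 := hw 1 3
  have h23 := hw 2 3
  simp [eta] at h00 h11 h22 h33 h01 h02 h03 h12 h13 h23
  -- Both sides are antisymmetric in `a b c`, so increasing triples suffice.
  refine sub_eq_zero.1 (antisymm_three_eq_zero (fun a b c => ∑ d, starComp a b c d * w d m -
    ∑ d, (w a d * starComp d b c m + w b d * starComp a d c m + w c d * starComp a b d m))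
    (fun i j k => ?_) (fun i j k => ?_) ?_ ?_ ?_ ?_ a b c)
  · simp only [Fin.sum_univ_four, s1 i j, s1 i _ k m, s1 _ j k m]
    ring
  · simp only [Fin.sum_univ_four, s2 i j k, s2 i _ k m, s2 i j _ m, s2 _ j k m]
    ring
  all_goals
    fin_cases m <;> simp [Fin.sum_univ_four, starComp, epsilon, eta] <;> linarith

/-- `⋆⋆ = -1` on `2`-forms, in components. -/
lemma star_star_two_comp (a : Fin 4 → Fin 4 → ℝ) (ha : ∀ i j, a j i = -a i j) (m n : Fin 4) :
    (1 / 2 : ℝ) * ∑ k, ∑ l, eta k * eta l *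
      ((1 / 2 : ℝ) * ∑ i, ∑ j, eta i * eta j * a i j * epsilon i j k l) * epsilon k l m n =
      -a m n := by
  have h0 : ∀ i, a i i = 0 := fun i => by linarith [ha i i]
  have h : ∀ k l, (1 / 2 : ℝ) * ∑ i, ∑ j, eta i * eta j * a i j * epsilon i j k l =
      !![0, a 2 3, -a 1 3, a 1 2; -a 2 3, 0, -a 0 3, a 0 2; a 1 3, a 0 3, 0, -a 0 1;
        -a 1 2, -a 0 2, a 0 1, 0] k l := by
    intro k l
    fin_cases k <;> fin_cases l <;>
      simp [Fin.sum_univ_four, epsilon, eta, h0, ha 0 1, ha 0 2, ha 0 3, ha 1 2, ha 1 3, ha 2 3] <;>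
      ring
  simp only [h]
  fin_cases m <;> fin_cases n <;>
    simp [Fin.sum_univ_four, epsilon, eta, h0, ha 0 1, ha 0 2, ha 0 3, ha 1 2, ha 1 3, ha 2 3] <;>
    ring

/-- `⋆⋆ = 1` on `3`-forms, in components. -/
lemma star_star_three_comp (a : Fin 4 → Fin 4 → Fin 4 → ℝ)
    (h1 : ∀ i j k, a j i k = -a i j k) (h2 : ∀ i j k, a i k j = -a i j k) (p q r : Fin 4) :
    ∑ l, eta l * ((1 / 6 : ℝ) * ∑ i, ∑ j, ∑ k, eta i * eta j * eta k * a i j k *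
      epsilon i j k l) * epsilon l p q r = a p q r := by
  have z1 : ∀ i k, a i i k = 0 := fun i k => by linarith [h1 i i k]
  have z2 : ∀ i k, a i k k = 0 := fun i k => by linarith [h2 i k k]
  have z3 : ∀ i k, a i k i = 0 := fun i k => by rw [h1, z2, neg_zero]
  have h : ∀ l, (1 / 6 : ℝ) * ∑ i, ∑ j, ∑ k, eta i * eta j * eta k * a i j k * epsilon i j k l =
      ![a 1 2 3, a 0 2 3, -a 0 1 3, a 0 1 2] l := by
    intro l
    fin_cases l <;>
      simp [Fin.sum_univ_four, epsilon, eta, z1, z2, z3, h1 0 1, h1 0 2, h1 0 3, h1 1 2, h1 1 3,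
        h2 _ 0 1, h2 _ 0 2, h2 _ 0 3, h2 _ 1 2, h2 _ 1 3, h2 _ 2 3] <;>
      ring
  simp only [h]
  -- Both sides are antisymmetric in `p q r`, so increasing triples suffice.
  refine sub_eq_zero.1 (antisymm_three_eq_zero (fun p q r =>
    ∑ l, eta l * ![a 1 2 3, a 0 2 3, -a 0 1 3, a 0 1 2] l * epsilon l p q r - a p q r)
    (fun i j k => ?_) (fun i j k => ?_) ?_ ?_ ?_ ?_ p q r)
  · simp only [Fin.sum_univ_four, epsilon_swap_right _ i j, h1 i j]
    ring
  · simp only [Fin.sum_univ_four, epsilon_swap_last _ i j k, h2 i j k]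
    ring
  all_goals simp [Fin.sum_univ_four, epsilon, eta]

/-- The pair symmetry of an array with the symmetries of a curvature tensor. -/
lemma pair_symm (R : Fin 4 → Fin 4 → Fin 4 → Fin 4 → ℝ)
    (h1 : ∀ a b c d, R b a c d = -R a b c d) (h2 : ∀ a b c d, R a b d c = -R a b c d)
    (hB : ∀ a b c d, R a b c d + R a c d b + R a d b c = 0) (a b c d : Fin 4) :
    R a b c d = R c d a b := by
  linarith [hB a b c d, hB b c d a, hB c d a b, hB d a b c, h1 a b c d, h1 c d a b, h2 a b c d,
    h2 c d a b, h1 a c b d, h1 a d b c, h2 a c b d, h2 a d b c, h1 b c a d, h1 b d a c,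
    h2 b c a d, h2 b d a c, h1 a c d b, h2 a c d b, h1 d b a c, h2 d b a c, h1 c b d a, h1 d a b c,
    h1 b c d a, h2 b c d a, h2 d a b c, h1 c a b d, h2 c a b d, h1 b d c a, h2 b d c a, h1 a d c b]

set_option maxHeartbeats 4000000 in
/-- The double dual of the curvature is the Einstein tensor: the components of
`½ ℛ_ab ∧ ⋆(θ^a ∧ θ^b ∧ θ^c) = -⋆𝒢^c` on an increasing triple of frame vectors. -/
lemma einstein_comp (R : Fin 4 → Fin 4 → Fin 4 → Fin 4 → ℝ)
    (h1 : ∀ a b c d, R b a c d = -R a b c d) (h2 : ∀ a b c d, R a b d c = -R a b c d)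
    (hp : ∀ a b c d, R a b c d = R c d a b) (c i j k : Fin 4) (hij : i < j) (hjk : j < k) :
    (1 / 2 : ℝ) * ∑ a, ∑ b, (R a b i j * starComp a b c k - R a b i k * starComp a b c j +
        R a b j k * starComp a b c i) =
      -∑ l, eta l * (eta c * (∑ d, eta d * R c d l d) -
        (1 / 2 : ℝ) * (∑ m, eta m * ∑ d, eta d * R m d m d) * (if c = l then 1 else 0)) *
          epsilon l i j k := by
  have z1 : ∀ a c d, R a a c d = 0 := fun a c d => by linarith [h1 a a c d]
  have z2 : ∀ a c d, R c d a a = 0 := fun a c d => by linarith [h2 c d a a]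
  have htriple : i = 0 ∧ j = 1 ∧ k = 2 ∨ i = 0 ∧ j = 1 ∧ k = 3 ∨ i = 0 ∧ j = 2 ∧ k = 3 ∨
      i = 1 ∧ j = 2 ∧ k = 3 := by
    revert i j k
    decide
  rcases htriple with ⟨rfl, rfl, rfl⟩ | ⟨rfl, rfl, rfl⟩ | ⟨rfl, rfl, rfl⟩ | ⟨rfl, rfl, rfl⟩ <;>
  fin_cases c <;>
  simp [Fin.sum_univ_four, starComp, epsilon, eta, z1, z2, h1 0 1, h1 0 2, h1 0 3, h1 1 2, h1 1 3,
    h1 2 3, h2 _ _ 0 1, h2 _ _ 0 2, h2 _ _ 0 3, h2 _ _ 1 2, h2 _ _ 1 3, h2 _ _ 2 3] <;>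
  linarith [hp 0 1 0 2, hp 0 1 0 3, hp 0 1 1 2, hp 0 1 1 3, hp 0 1 2 3, hp 0 2 0 3, hp 0 2 1 2,
    hp 0 2 1 3, hp 0 2 2 3, hp 0 3 1 2, hp 0 3 1 3, hp 0 3 2 3, hp 1 2 1 3, hp 1 2 2 3, hp 1 3 2 3]

end LeviCivitaSymbol

/-! ### Orthonormal frames and the Hodge star -/

section Frame

variable {V : Type*} [AddCommGroup V] [Module ℝ V] [TopologicalSpace V]

lemma sum_fun_one (F : (Fin 1 → Fin 4) → ℝ) : ∑ f, F f = ∑ a, F ![a] :=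
  Fintype.sum_equiv (Equiv.funUnique (Fin 1) (Fin 4)) _ _ fun f => by
    rw [vec_one f]; rfl

lemma sum_fun_succ {n : ℕ} (F : (Fin (n + 1) → Fin 4) → ℝ) :
    ∑ f, F f = ∑ a, ∑ g : Fin n → Fin 4, F (Fin.cons a g) := by
  rw [← Fintype.sum_prod_type' (f := fun a g => F (Fin.cons a g))]
  exact (Equiv.sum_comp (Fin.consEquiv fun _ : Fin (n + 1) => Fin 4) F).symm

lemma sum_fun_two (F : (Fin 2 → Fin 4) → ℝ) : ∑ f, F f = ∑ a, ∑ b, F ![a, b] := by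
  rw [sum_fun_succ]
  exact Finset.sum_congr rfl fun a _ => sum_fun_one fun g => F (Fin.cons a g)

lemma sum_fun_three (F : (Fin 3 → Fin 4) → ℝ) : ∑ f, F f = ∑ a, ∑ b, ∑ c, F ![a, b, c] := by
  rw [sum_fun_succ]
  exact Finset.sum_congr rfl fun a _ => sum_fun_two fun g => F (Fin.cons a g)

/-- The volume form `θ⁰ ∧ θ¹ ∧ θ² ∧ θ³`. -/
def frameVol (θ : Fin 4 → V →L[ℝ] ℝ) : V [⋀^Fin 4]→L[ℝ] ℝ :=
  wedge (wedge (wedge (oneForm (θ 0)) (oneForm (θ 1))) (oneForm (θ 2))) (oneForm (θ 3))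

variable {e : Fin 4 → V} {θ : Fin 4 → V →L[ℝ] ℝ}

lemma frameVol_apply (hd : ∀ a b, θ a (e b) = if a = b then 1 else 0) (i j k l : Fin 4) :
    frameVol θ ![e i, e j, e k, e l] = epsilon i j k l := by
  rw [← epsilon_eq_sum_delta i j k l (fun a b => θ a (e b)) hd]
  unfold frameVol
  erw [wedge_three_one]
  erw [wedge_two_one, wedge_two_one, wedge_two_one, wedge_two_one]
  simp only [wedge_one_one, oneForm_apply]
  rfl

/-- A form is determined by its values on the vectors of a frame. -/
lemma form_ext (hs : ∀ v, v = ∑ a, θ a v • e a) {n : ℕ} {A B : V [⋀^Fin n]→L[ℝ] ℝ}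
    (h : ∀ i : Fin n → Fin 4, A (fun j => e (i j)) = B (fun j => e (i j))) : A = B := by
  ext v
  have hv : v = fun j => ∑ a, θ a (v j) • e a := funext fun j => hs (v j)
  rw [hv]
  have key : ∀ C : V [⋀^Fin n]→L[ℝ] ℝ, C (fun j => ∑ a, θ a (v j) • e a) =
      ∑ i : Fin n → Fin 4, (∏ j, θ (i j) (v j)) * C (fun j => e (i j)) := by
    intro C
    refine (C.toMultilinearMap.map_sum fun j a => θ a (v j) • e a).trans ?_
    refine Finset.sum_congr rfl fun i _ => ?_
    exact C.toMultilinearMap.map_smul_univ _ _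
  simp only [key, h]

lemma form_ext_one (hs : ∀ v, v = ∑ a, θ a v • e a) {A B : V [⋀^Fin 1]→L[ℝ] ℝ}
    (h : ∀ i, A ![e i] = B ![e i]) : A = B :=
  form_ext hs fun i => by rw [vec_one fun j => e (i j)]; exact h _

lemma form_ext_two (hs : ∀ v, v = ∑ a, θ a v • e a) {A B : V [⋀^Fin 2]→L[ℝ] ℝ}
    (h : ∀ i j, A ![e i, e j] = B ![e i, e j]) : A = B :=
  form_ext hs fun i => by rw [vec_two fun j => e (i j)]; exact h _ _

lemma form_ext_three (hs : ∀ v, v = ∑ a, θ a v • e a) {A B : V [⋀^Fin 3]→L[ℝ] ℝ}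
    (h : ∀ i j k, i < j → j < k → A ![e i, e j, e k] = B ![e i, e j, e k]) : A = B :=
  form_ext hs fun i => by
    rw [vec_three fun j => e (i j)]
    have := antisymm_three_eq_zero (fun i j k => A ![e i, e j, e k] - B ![e i, e j, e k])
      (fun i j k => by simp only [alt_three_swap _ (e i) (e j)]; ring)
      (fun i j k => by simp only [alt_three_swap' _ (e i) (e j) (e k)]; ring)
      (sub_eq_zero.2 (h _ _ _ (by decide) (by decide)))
      (sub_eq_zero.2 (h _ _ _ (by decide) (by decide)))
      (sub_eq_zero.2 (h _ _ _ (by decide) (by decide)))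
      (sub_eq_zero.2 (h _ _ _ (by decide) (by decide))) (i 0) (i 1) (i 2)
    exact sub_eq_zero.1 this

variable [IsTopologicalAddGroup V]

lemma hodgeStar_one_apply (hd : ∀ a b, θ a (e b) = if a = b then 1 else 0)
    (A : V [⋀^Fin 1]→L[ℝ] ℝ) (i j k : Fin 4) :
    hodgeStar (m := 3) rfl e (frameVol θ) A ![e i, e j, e k] =
      ∑ l, eta l * A ![e l] * epsilon l i j k := by
  simp only [hodgeStar, ContinuousAlternatingMap.smul_apply, ContinuousAlternatingMap.sum_apply,
    smul_eq_mul, sum_fun_one, ← frameVol_apply hd]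
  rw [Nat.factorial_one, Nat.cast_one, inv_one, one_mul]
  refine Finset.sum_congr rfl fun l _ => ?_
  rw [Fin.prod_univ_one]
  congr 1
  rw [vec_one fun j => e (![l] j)]
  rfl

lemma hodgeStar_two_apply (hd : ∀ a b, θ a (e b) = if a = b then 1 else 0)
    (A : V [⋀^Fin 2]→L[ℝ] ℝ) (k l : Fin 4) :
    hodgeStar (m := 2) rfl e (frameVol θ) A ![e k, e l] =
      (1 / 2 : ℝ) * ∑ i, ∑ j, eta i * eta j * A ![e i, e j] * epsilon i j k l := by
  simp only [hodgeStar, ContinuousAlternatingMap.smul_apply, ContinuousAlternatingMap.sum_apply,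
    smul_eq_mul, sum_fun_two, ← frameVol_apply hd]
  congr 1
  · norm_num [Nat.factorial]
  refine Finset.sum_congr rfl fun i _ => Finset.sum_congr rfl fun j _ => ?_
  rw [Fin.prod_univ_two]
  congr 1
  rw [vec_two fun j' => e (![i, j] j')]
  rfl

lemma hodgeStar_three_apply (hd : ∀ a b, θ a (e b) = if a = b then 1 else 0)
    (A : V [⋀^Fin 3]→L[ℝ] ℝ) (l : Fin 4) :
    hodgeStar (m := 1) rfl e (frameVol θ) A ![e l] =
      (1 / 6 : ℝ) * ∑ i, ∑ j, ∑ k, eta i * eta j * eta k * A ![e i, e j, e k] *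
        epsilon i j k l := by
  simp only [hodgeStar, ContinuousAlternatingMap.smul_apply, ContinuousAlternatingMap.sum_apply,
    smul_eq_mul, sum_fun_three, ← frameVol_apply hd]
  congr 1
  · norm_num [Nat.factorial]
  refine Finset.sum_congr rfl fun i _ => Finset.sum_congr rfl fun j _ =>
    Finset.sum_congr rfl fun k _ => ?_
  rw [Fin.prod_univ_three]
  congr 1
  rw [vec_three fun j' => e (![i, j, k] j')]
  rfl

lemma hodgeStar_hodgeStar_two (hd : ∀ a b, θ a (e b) = if a = b then 1 else 0)
    (hs : ∀ v, v = ∑ a, θ a v • e a) (A : V [⋀^Fin 2]→L[ℝ] ℝ) :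
    hodgeStar (m := 2) rfl e (frameVol θ) (hodgeStar (m := 2) rfl e (frameVol θ) A) = -A := by
  refine form_ext_two hs fun i j => ?_
  simp only [hodgeStar_two_apply hd]
  exact star_star_two_comp (fun i j => A ![e i, e j]) (fun i j => alt_two_swap A _ _) i j

lemma hodgeStar_hodgeStar_three (hd : ∀ a b, θ a (e b) = if a = b then 1 else 0)
    (hs : ∀ v, v = ∑ a, θ a v • e a) (A : V [⋀^Fin 3]→L[ℝ] ℝ) :
    hodgeStar (m := 3) rfl e (frameVol θ) (hodgeStar (m := 1) rfl e (frameVol θ) A) = A := by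
  refine form_ext_three hs fun i j k _ _ => ?_
  simp only [hodgeStar_one_apply hd, hodgeStar_three_apply hd]
  exact star_star_three_comp (fun i j k => A ![e i, e j, e k])
    (fun i j k => alt_three_swap A _ _ _) (fun i j k => alt_three_swap' A _ _ _) i j k

/-- `⋆(θ^a ∧ θ^b ∧ θ^c) = ε^{abc}_d θ^d`. -/
lemma hodgeStar_wedge_coframe (hd : ∀ a b, θ a (e b) = if a = b then 1 else 0)
    (hs : ∀ v, v = ∑ a, θ a v • e a) (a b c : Fin 4) :
    hodgeStar (k := 3) (m := 1) rfl e (frameVol θ)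
        (wedge (wedge (oneForm (θ a)) (oneForm (θ b))) (oneForm (θ c))) =
      ∑ d, starComp a b c d • oneForm (θ d) := by
  refine form_ext_one hs fun d => ?_
  rw [hodgeStar_three_apply hd]
  have h : ∀ i j k, wedge (wedge (oneForm (θ a)) (oneForm (θ b))) (oneForm (θ c))
      ![e i, e j, e k] = θ a (e i) * θ b (e j) * θ c (e k) - θ a (e j) * θ b (e i) * θ c (e k)
        - θ a (e i) * θ b (e k) * θ c (e j) + θ a (e k) * θ b (e i) * θ c (e j)
        + θ a (e j) * θ b (e k) * θ c (e i) - θ a (e k) * θ b (e j) * θ c (e i) := by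
    intro i j k
    erw [wedge_two_one]
    simp only [wedge_one_one, oneForm_apply]
    simp
    ring
  erw [Finset.sum_congr rfl fun i _ => Finset.sum_congr rfl fun j _ =>
    Finset.sum_congr rfl fun k _ => by rw [h i j k]]
  simp only [hd, ContinuousAlternatingMap.sum_apply, ContinuousAlternatingMap.smul_apply,
    oneForm_apply, smul_eq_mul]
  simp [mul_add, mul_sub, add_mul, sub_mul, Finset.sum_add_distrib, Finset.sum_sub_distrib, hd]
  simp only [starComp]
  have e1 : epsilon a c b d = -epsilon a b c d := epsilon_swap_right a b c d
  have e2 : epsilon b a c d = -epsilon a b c d := epsilon_swap_left a b c d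
  have e3 : epsilon b c a d = epsilon a b c d := by rw [epsilon_swap_right b a c, e2, neg_neg]
  have e4 : epsilon c a b d = epsilon a b c d := by rw [epsilon_swap_left a c b, e1, neg_neg]
  have e5 : epsilon c b a d = -epsilon a b c d := by rw [epsilon_swap_left b c a, e3]
  simp only [e1, e2, e3, e4, e5]
  ring

/-- The Hodge star is injective on `1`-forms. -/
lemma hodgeStar_one_injective (hd : ∀ a b, θ a (e b) = if a = b then 1 else 0)
    (hs : ∀ v, v = ∑ a, θ a v • e a) {A B : V [⋀^Fin 1]→L[ℝ] ℝ}
    (h : hodgeStar (m := 3) rfl e (frameVol θ) A = hodgeStar (m := 3) rfl e (frameVol θ) B) :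
    A = B := by
  have h' : ∀ i j k, ∑ l, eta l * A ![e l] * epsilon l i j k =
      ∑ l, eta l * B ![e l] * epsilon l i j k := fun i j k => by
    rw [← hodgeStar_one_apply hd, ← hodgeStar_one_apply hd, h]
  have h0 := h' 1 2 3
  have h1 := h' 0 2 3
  have h2 := h' 0 1 3
  have h3 := h' 0 1 2
  simp [Fin.sum_univ_four, epsilon, eta] at h0 h1 h2 h3
  refine form_ext_one hs fun l => ?_
  fin_cases l <;> assumption

lemma hodgeStar_neg {k m : ℕ} (h : k + m = 4) (τ : V [⋀^Fin 4]→L[ℝ] ℝ) (A : V [⋀^Fin k]→L[ℝ] ℝ) :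
    hodgeStar h e τ (-A) = -hodgeStar h e τ A := by
  ext v
  simp only [hodgeStar, ContinuousAlternatingMap.smul_apply, ContinuousAlternatingMap.sum_apply,
    ContinuousAlternatingMap.neg_apply, smul_eq_mul, mul_neg, neg_mul, Finset.sum_neg_distrib]

lemma hodgeStar_neg_hodgeStar_two (hd : ∀ a b, θ a (e b) = if a = b then 1 else 0)
    (hs : ∀ v, v = ∑ a, θ a v • e a) (A : V [⋀^Fin 2]→L[ℝ] ℝ) :
    hodgeStar (m := 2) rfl e (frameVol θ) (-hodgeStar (m := 2) rfl e (frameVol θ) A) = A := by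
  rw [hodgeStar_neg, hodgeStar_hodgeStar_two hd hs, neg_neg]

/-- For a matrix `R_ab` of `2`-forms that is antisymmetric and satisfies the first Bianchi identity,
`½ R_ab ∧ ⋆(θ^a ∧ θ^b ∧ θ^c)` is minus the Hodge dual of the Einstein `1`-form of `R`. -/
lemma einstein_form (hd : ∀ a b, θ a (e b) = if a = b then 1 else 0)
    (hs : ∀ v, v = ∑ a, θ a v • e a) (R : Fin 4 → Fin 4 → V [⋀^Fin 2]→L[ℝ] ℝ)
    (hR : ∀ a b, R b a = -R a b) (hB : ∀ a, ∑ b, wedge (R a b) (oneForm (θ b)) = 0) (c : Fin 4) :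
    (1 / 2 : ℝ) • ∑ a, ∑ b, wedge (R a b) (hodgeStar (k := 3) (m := 1) rfl e (frameVol θ)
        (wedge (wedge (oneForm (θ a)) (oneForm (θ b))) (oneForm (θ c)))) =
      -hodgeStar (m := 3) rfl e (frameVol θ)
        (∑ l, (eta c * ∑ d, eta d * R c d ![e l, e d]) • oneForm (θ l) -
          (1 / 2 * ∑ m, eta m * ∑ d, eta d * R m d ![e m, e d]) • oneForm (θ c)) := by
  have h1 : ∀ a b i j, R b a ![e i, e j] = -R a b ![e i, e j] := fun a b i j => by rw [hR]; rfl
  have h2 : ∀ a b i j, R a b ![e j, e i] = -R a b ![e i, e j] := fun a b i j => alt_two_swap _ _ _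
  have hB' : ∀ a b i j, R a b ![e i, e j] + R a i ![e j, e b] + R a j ![e b, e i] = 0 := by
    intro a b i j
    have := congrArg (fun A : V [⋀^Fin 3]→L[ℝ] ℝ => A ![e i, e j, e b]) (hB a)
    simp only [ContinuousAlternatingMap.sum_apply, show ∀ v : Fin 3 → V,
      (0 : V [⋀^Fin 3]→L[ℝ] ℝ) v = 0 from fun _ => rfl] at this
    erw [Finset.sum_congr rfl fun m _ => wedge_two_one (R a m) (oneForm (θ m)) ![e i, e j, e b]]
      at this
    simp [oneForm_apply, hd, Finset.sum_add_distrib, Finset.sum_sub_distrib] at this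
    rw [h2 a i b j, h2 a j i b] at *
    linarith
  have hp := pair_symm (fun a b i j => R a b ![e i, e j]) h1 h2 hB'
  refine form_ext_three hs fun i j k hij hjk => ?_
  have := einstein_comp (fun a b i j => R a b ![e i, e j]) h1 h2 hp c i j k hij hjk
  simp only [hodgeStar_wedge_coframe hd hs]
  rw [ContinuousAlternatingMap.neg_apply, hodgeStar_one_apply hd,
    ContinuousAlternatingMap.smul_apply]
  simp only [ContinuousAlternatingMap.sum_apply]
  erw [Finset.sum_congr rfl fun a _ => Finset.sum_congr rfl fun b _ =>
    wedge_two_one (R a b) (∑ d, starComp a b c d • oneForm (θ d)) ![e i, e j, e k]]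
  simp only [ContinuousAlternatingMap.sum_apply, ContinuousAlternatingMap.sub_apply,
    ContinuousAlternatingMap.smul_apply, oneForm_apply, smul_eq_mul, Matrix.cons_val, hd]
  simp only [mul_ite, mul_one, mul_zero, Finset.sum_ite_eq', Finset.mem_univ, if_true]
  simpa using this

end Frame

/-! ### Algebra of the exterior product -/

section WedgeAlgebra

variable {V : Type*} [AddCommGroup V] [Module ℝ V] [TopologicalSpace V]

lemma wedge_compContinuousLinearMap {W : Type*} [AddCommGroup W] [Module ℝ W] [TopologicalSpace W]
    {p q : ℕ} (α : V [⋀^Fin p]→L[ℝ] ℝ) (β : V [⋀^Fin q]→L[ℝ] ℝ) (L : W →L[ℝ] V) :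
    (wedge α β).compContinuousLinearMap L =
      wedge (α.compContinuousLinearMap L) (β.compContinuousLinearMap L) := by
  ext v
  rw [ContinuousAlternatingMap.compContinuousLinearMap_apply, wedge_apply, wedge_apply]
  rfl

variable {p q : ℕ}

lemma wedge_smul_left (c : ℝ) (α : V [⋀^Fin p]→L[ℝ] ℝ)
    (β : V [⋀^Fin q]→L[ℝ] ℝ) : wedge (c • α) β = c • wedge α β := by
  ext v
  simp only [wedge_apply, ContinuousAlternatingMap.smul_apply, smul_eq_mul, Finset.mul_sum]
  exact Finset.sum_congr rfl fun σ _ => by ring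

lemma wedge_smul_right (c : ℝ) (α : V [⋀^Fin p]→L[ℝ] ℝ) (β : V [⋀^Fin q]→L[ℝ] ℝ) :
    wedge α (c • β) = c • wedge α β := by
  ext v
  simp only [wedge_apply, ContinuousAlternatingMap.smul_apply, smul_eq_mul, Finset.mul_sum]
  exact Finset.sum_congr rfl fun σ _ => by ring

lemma wedge_add_left (α α' : V [⋀^Fin p]→L[ℝ] ℝ) (β : V [⋀^Fin q]→L[ℝ] ℝ) :
    wedge (α + α') β = wedge α β + wedge α' β := by
  ext v
  simp only [wedge_apply, ContinuousAlternatingMap.add_apply, ← mul_add, ← Finset.sum_add_distrib]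
  congr 1
  exact Finset.sum_congr rfl fun σ _ => by ring

lemma wedge_add_right (α : V [⋀^Fin p]→L[ℝ] ℝ) (β β' : V [⋀^Fin q]→L[ℝ] ℝ) :
    wedge α (β + β') = wedge α β + wedge α β' := by
  ext v
  simp only [wedge_apply, ContinuousAlternatingMap.add_apply, ← mul_add, ← Finset.sum_add_distrib]

lemma wedge_sum_left {ι : Type*} (s : Finset ι) (α : ι → V [⋀^Fin p]→L[ℝ] ℝ)
    (β : V [⋀^Fin q]→L[ℝ] ℝ) : wedge (∑ i ∈ s, α i) β = ∑ i ∈ s, wedge (α i) β :=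
  map_sum (AddMonoidHom.mk' (fun α : V [⋀^Fin p]→L[ℝ] ℝ => wedge α β)
    fun α α' => wedge_add_left α α' β) α s

lemma wedge_sum_right {ι : Type*} (s : Finset ι) (α : V [⋀^Fin p]→L[ℝ] ℝ)
    (β : ι → V [⋀^Fin q]→L[ℝ] ℝ) : wedge α (∑ i ∈ s, β i) = ∑ i ∈ s, wedge α (β i) :=
  map_sum (AddMonoidHom.mk' (fun β : V [⋀^Fin q]→L[ℝ] ℝ => wedge α β)
    fun β β' => wedge_add_right α β β') β s

lemma wedge_neg_right (α : V [⋀^Fin p]→L[ℝ] ℝ) (β : V [⋀^Fin q]→L[ℝ] ℝ) :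
    wedge α (-β) = -wedge α β := by
  ext v
  simp only [wedge_apply, ContinuousAlternatingMap.neg_apply, mul_neg, Finset.sum_neg_distrib]

lemma wedge_neg_left (α : V [⋀^Fin p]→L[ℝ] ℝ) (β : V [⋀^Fin q]→L[ℝ] ℝ) :
    wedge (-α) β = -wedge α β := by
  ext v
  simp only [wedge_apply, ContinuousAlternatingMap.neg_apply, mul_neg, neg_mul,
    Finset.sum_neg_distrib]

lemma wedge_assoc_one (α β γ : V [⋀^Fin 1]→L[ℝ] ℝ) :
    wedge α (wedge β γ) = wedge (wedge α β) γ := by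
  ext v
  erw [wedge_two_one, wedge_one_two]
  simp only [wedge_one_one]
  simp
  ring

lemma wedge_one_anticomm (α β : V [⋀^Fin 1]→L[ℝ] ℝ) : wedge β α = -wedge α β := by
  ext v
  erw [ContinuousAlternatingMap.neg_apply, wedge_one_one, wedge_one_one]
  ring

end WedgeAlgebra

section SuperpotentialAlgebra

variable {V : Type*} [AddCommGroup V] [Module ℝ V] [TopologicalSpace V]

/-- The `1`-form `⋆(θ^a ∧ θ^b ∧ θ^c)`, expanded in the coframe. -/
def starTriple (θ : Fin 4 → V [⋀^Fin 1]→L[ℝ] ℝ) (a b c : Fin 4) : V [⋀^Fin 1]→L[ℝ] ℝ :=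
  ∑ d, starComp a b c d • θ d

/-- If `dθ^d = -Ω^d_m ∧ θ^m`, then `d ⋆(θ^a ∧ θ^b ∧ θ^c)` is minus the right-hand side: a
metric connection annihilates the volume form. -/
lemma sum_starComp_wedge (θ : Fin 4 → V [⋀^Fin 1]→L[ℝ] ℝ) (Ω : Fin 4 → Fin 4 → V [⋀^Fin 1]→L[ℝ] ℝ)
    (hΩ : ∀ a b, eta a • Ω a b = -(eta b • Ω b a)) (a b c : Fin 4) :
    ∑ d, starComp a b c d • ∑ m, wedge (Ω d m) (θ m) =
      ∑ d, (wedge (Ω a d) (starTriple θ d b c) + wedge (Ω b d) (starTriple θ a d c) +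
        wedge (Ω c d) (starTriple θ a b d)) := by
  have key : ∀ m, ∑ d, starComp a b c d • Ω d m =
      ∑ d, (starComp d b c m • Ω a d + starComp a d c m • Ω b d + starComp a b d m • Ω c d) := by
    intro m
    ext u
    have := starComp_invariant (fun a b => Ω a b u)
      (fun a b => by simpa using congrArg (fun A : V [⋀^Fin 1]→L[ℝ] ℝ => A u) (hΩ a b)) a b c m
    simpa [mul_comm] using this
  have hl : ∑ d, starComp a b c d • ∑ m, wedge (Ω d m) (θ m) =
      ∑ m, wedge (∑ d, starComp a b c d • Ω d m) (θ m) := by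
    simp only [wedge_sum_left, wedge_smul_left, Finset.smul_sum]
    exact Finset.sum_comm
  rw [hl]
  simp only [key, starTriple, wedge_sum_left, wedge_sum_right, wedge_add_left, wedge_smul_left,
    wedge_smul_right]
  rw [Finset.sum_comm]
  simp only [Finset.sum_add_distrib]

/-- With `F^a_b` in the role of `dω^a_b`, the left side is `ℛ_ab ∧ ⋆(θ^a ∧ θ^b ∧ θ^c)`; on the
right, the first sum is `2 d⋆𝒮^c` and the second is `-2 ⋆𝔱^c`. -/
lemma superpotential_algebra (θ : Fin 4 → V [⋀^Fin 1]→L[ℝ] ℝ)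
    (Ω : Fin 4 → Fin 4 → V [⋀^Fin 1]→L[ℝ] ℝ) (F : Fin 4 → Fin 4 → V [⋀^Fin 2]→L[ℝ] ℝ)
    (hΩ : ∀ a b, eta a • Ω a b = -(eta b • Ω b a)) (c : Fin 4) :
    ∑ a, ∑ b, wedge (eta a • (F a b + ∑ m, wedge (Ω a m) (Ω m b))) (starTriple θ a b c) =
      ∑ a, ∑ b, eta a • (wedge (F a b) (starTriple θ a b c) + wedge (Ω a b)
        (∑ d, starComp a b c d • ∑ m, wedge (Ω d m) (θ m))) -
      ∑ a, ∑ b, wedge (eta a • Ω a b) (∑ d, (wedge (Ω c d) (starTriple θ a b d) +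
        wedge (Ω b d) (starTriple θ a d c))) := by
  have hF : ∀ a b, wedge (eta a • (F a b + ∑ m, wedge (Ω a m) (Ω m b))) (starTriple θ a b c) =
      eta a • wedge (F a b) (starTriple θ a b c) +
        ∑ m, eta a • wedge (wedge (Ω a m) (Ω m b)) (starTriple θ a b c) := by
    intro a b
    simp only [wedge_smul_left, wedge_add_left, wedge_sum_left, smul_add, Finset.smul_sum]
  -- The quadratic part of the curvature is the action of `Ω` on the index `a` of `⋆θ^{abc}`.
  have hm : ∑ a, ∑ b, ∑ m, eta a • wedge (wedge (Ω a m) (Ω m b)) (starTriple θ a b c) =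
      ∑ a, ∑ b, ∑ d, eta a • wedge (Ω a b) (wedge (Ω a d) (starTriple θ d b c)) := by
    have h1 : ∀ a b d, eta a • wedge (Ω a b) (wedge (Ω a d) (starTriple θ d b c)) =
        eta d • wedge (wedge (Ω d a) (Ω a b)) (starTriple θ d b c) := by
      intro a b d
      rw [wedge_assoc_one, wedge_one_anticomm (Ω a d), ← wedge_smul_left, smul_neg,
        ← wedge_smul_left, ← wedge_smul_left, ← wedge_smul_left (eta d), hΩ d a, wedge_neg_left,
        wedge_neg_left, wedge_neg_left]
    simp only [h1]
    rw [Finset.sum_congr rfl fun a _ => Finset.sum_comm, Finset.sum_comm]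
    exact Finset.sum_congr rfl fun a _ => Finset.sum_comm
  simp only [hF, sum_starComp_wedge θ Ω hΩ, Finset.sum_add_distrib, hm]
  simp only [wedge_sum_right, wedge_add_right, wedge_smul_left, smul_add, Finset.smul_sum,
    Finset.sum_add_distrib]
  abel

end SuperpotentialAlgebra

/-! ### Exterior calculus of a moving frame -/

/-- In dimension four, four vectors with a dual family of covectors form a basis. -/
lemma eq_sum_of_dual {V : Type*} [AddCommGroup V] [Module ℝ V] [TopologicalSpace V]
    (hV : Module.finrank ℝ V = 4) {e : Fin 4 → V} {θ : Fin 4 → V →L[ℝ] ℝ}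
    (hd : ∀ a b, θ a (e b) = if a = b then 1 else 0) (v : V) : v = ∑ a, θ a v • e a := by
  have hli : LinearIndependent ℝ e := by
    rw [Fintype.linearIndependent_iff]
    intro c hc a
    simpa [hd] using congrArg (θ a) hc
  let b := basisOfLinearIndependentOfCardEqFinrank hli (by simp [hV])
  have hb : ∀ a, b a = e a := fun a => by simp [b]
  have hv := b.sum_repr v
  simp only [hb] at hv
  have hr : ∀ a, θ a v = b.repr v a := fun a => by
    conv_lhs => rw [← hv]
    simp [hd]
  simp only [hr, hv]

section FlatForms

variable {E : Type*} [NormedAddCommGroup E] [NormedSpace ℝ E]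

/-- `oneForm` as a continuous linear map. -/
def oneFormCLM : (E →L[ℝ] ℝ) →L[ℝ] E [⋀^Fin 1]→L[ℝ] ℝ :=
  (ContinuousAlternatingMap.ofSubsingletonLIE (𝕜 := ℝ) (E := E) (F := ℝ)
    (i := (0 : Fin 1))).toContinuousLinearEquiv.toContinuousLinearMap

lemma differentiableAt_oneForm {α : E → E →L[ℝ] ℝ} {x : E} (hα : DifferentiableAt ℝ α x) :
    DifferentiableAt ℝ (fun y => oneForm (α y)) x :=
  (oneFormCLM (E := E)).differentiableAt.comp x hα

lemma contDiffAt_oneForm {n : WithTop ℕ∞} {α : E → E →L[ℝ] ℝ} {x : E} (hα : ContDiffAt ℝ n α x) :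
    ContDiffAt ℝ n (fun y => oneForm (α y)) x :=
  (oneFormCLM (E := E)).contDiff.contDiffAt.comp x hα

lemma isBoundedBilinearMap_wedge_oneForm :
    IsBoundedBilinearMap ℝ
      (fun p : (E →L[ℝ] ℝ) × (E →L[ℝ] ℝ) => wedge (oneForm p.1) (oneForm p.2)) where
  add_left α α' β := wedge_add_left (oneForm α) (oneForm α') (oneForm β)
  smul_left c α β := wedge_smul_left c (oneForm α) (oneForm β)
  add_right α β β' := wedge_add_right (oneForm α) (oneForm β) (oneForm β')
  smul_right c α β := wedge_smul_right c (oneForm α) (oneForm β)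
  bound := by
    refine ⟨2, by norm_num, fun α β => ?_⟩
    refine ContinuousAlternatingMap.opNorm_le_bound _ (by positivity) fun v => ?_
    erw [wedge_one_one, Fin.prod_univ_two]
    have h : ∀ u w : E, |α u * β w| ≤ ‖α‖ * ‖β‖ * (‖u‖ * ‖w‖) := fun u w => by
      rw [abs_mul]
      calc |α u| * |β w| ≤ (‖α‖ * ‖u‖) * (‖β‖ * ‖w‖) := by
            gcongr
            exacts [α.le_opNorm u, β.le_opNorm w]
        _ = _ := by ring
    have h1 := h (v 0) (v 1)
    have h2 := h (v 1) (v 0)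
    calc |α (v 0) * β (v 1) - α (v 1) * β (v 0)|
        ≤ |α (v 0) * β (v 1)| + |α (v 1) * β (v 0)| := abs_sub _ _
      _ ≤ 2 * ‖α‖ * ‖β‖ * (‖v 0‖ * ‖v 1‖) := by linarith

lemma differentiableAt_wedge {α β : E → E →L[ℝ] ℝ} {x : E} (hα : DifferentiableAt ℝ α x)
    (hβ : DifferentiableAt ℝ β x) :
    DifferentiableAt ℝ (fun y => wedge (oneForm (α y)) (oneForm (β y))) x :=
  DifferentiableAt.comp (g := fun p : (E →L[ℝ] ℝ) × (E →L[ℝ] ℝ) =>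
    wedge (oneForm p.1) (oneForm p.2)) (f := fun y => (α y, β y)) x
    (isBoundedBilinearMap_wedge_oneForm.differentiableAt (α x, β x)) (hα.prodMk hβ)

lemma extDeriv_oneForm_apply {α : E → E →L[ℝ] ℝ} {x : E} (hα : DifferentiableAt ℝ α x)
    (v : Fin 2 → E) :
    extDeriv (fun y => oneForm (α y)) x v =
      fderiv ℝ α x (v 0) (v 1) - fderiv ℝ α x (v 1) (v 0) := by
  rw [extDeriv_apply (differentiableAt_oneForm hα)]
  simp only [oneForm_apply]
  have h : ∀ w : E, fderiv ℝ (fun y => α y w) x = (fderiv ℝ α x).flip w := fun w => by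
    ext u
    simp [fderiv_clm_apply hα (differentiableAt_const w)]
  simp [h, Fin.sum_univ_two, Fin.removeNth]
  ring

/-- The graded Leibniz rule for a product of two `1`-forms. -/
lemma extDeriv_wedge {α β : E → E →L[ℝ] ℝ} {x : E} (hα : DifferentiableAt ℝ α x)
    (hβ : DifferentiableAt ℝ β x) :
    extDeriv (fun y => wedge (oneForm (α y)) (oneForm (β y))) x =
      wedge (extDeriv (fun y => oneForm (α y)) x) (oneForm (β x)) -
        wedge (oneForm (α x)) (extDeriv (fun y => oneForm (β y)) x) := by
  ext v
  rw [ContinuousAlternatingMap.sub_apply]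
  erw [wedge_two_one, wedge_one_two]
  rw [extDeriv_apply (differentiableAt_wedge hα hβ)]
  simp only [extDeriv_oneForm_apply hα, extDeriv_oneForm_apply hβ]
  have h : ∀ u w z : E, fderiv ℝ (fun y => wedge (oneForm (α y)) (oneForm (β y)) ![u, w]) x z =
      fderiv ℝ α x z u * β x w + α x u * fderiv ℝ β x z w - (fderiv ℝ α x z w * β x u +
        α x w * fderiv ℝ β x z u) := by
    intro u w z
    have : (fun y => wedge (oneForm (α y)) (oneForm (β y)) ![u, w]) =
      fun y => α y u * β y w - α y w * β y u := by
      ext y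
      erw [wedge_one_one]
      rfl
    rw [this]
    have ha : ∀ u, HasFDerivAt (fun y => α y u) ((fderiv ℝ α x).flip u) x := fun u => by
      simpa using hα.hasFDerivAt.clm_apply (hasFDerivAt_const u x)
    have hb : ∀ u, HasFDerivAt (fun y => β y u) ((fderiv ℝ β x).flip u) x := fun u => by
      simpa using hβ.hasFDerivAt.clm_apply (hasFDerivAt_const u x)
    have hab : HasFDerivAt (fun y => α y u * β y w - α y w * β y u) _ x :=
      ((ha u).mul (hb w)).sub ((ha w).mul (hb u))
    rw [hab.fderiv]
    simp
    ring
  have h2 : ∀ i : Fin 3, (i.removeNth v) = ![v (i.succAbove 0), v (i.succAbove 1)] := fun i => by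
    ext j; fin_cases j <;> rfl
  have h3 := fun i : Fin 3 => h (v (i.succAbove 0)) (v (i.succAbove 1)) (v i)
  simp only [← h2] at h3
  refine (Fin.sum_univ_three _).trans ?_
  erw [h3 0, h3 1, h3 2]
  simp [Fin.succAbove, oneForm_apply]
  ring

/-- The exterior derivative commutes with linear combinations. -/
lemma extDeriv_sum_smul {n : ℕ} {ι : Type*} (s : Finset ι) (c : ι → ℝ)
    {A : ι → E → E [⋀^Fin n]→L[ℝ] ℝ} {x : E} (h : ∀ i ∈ s, DifferentiableAt ℝ (A i) x) :
    extDeriv (fun y => ∑ i ∈ s, c i • A i y) x = ∑ i ∈ s, c i • extDeriv (A i) x := by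
  have : fderiv ℝ (fun y => ∑ i ∈ s, c i • A i y) x = ∑ i ∈ s, c i • fderiv ℝ (A i) x := by
    rw [fderiv_fun_sum fun i hi => (h i hi).fun_const_smul (c i)]
    exact Finset.sum_congr rfl fun i hi => fderiv_fun_const_smul (h i hi) _
  simp only [extDeriv, this, ← ContinuousAlternatingMap.alternatizeUncurryFinCLM_apply, map_sum,
    map_smul]

variable {Θ : Fin 4 → E → E →L[ℝ] ℝ} {Ω : Fin 4 → Fin 4 → E → E →L[ℝ] ℝ} {x : E}

/-- First Bianchi identity, from `d(dΘ^a) = 0` and the structure equation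
`dΘ^a = -Ω^a_b ∧ Θ^b`. -/
lemma first_bianchi (hΘ : ∀ a, ContDiffAt ℝ 2 (Θ a) x) (hΩ : ∀ a b, DifferentiableAt ℝ (Ω a b) x)
    (hstr : ∀ a, ∀ᶠ y in 𝓝 x, extDeriv (fun y => oneForm (Θ a y)) y =
      -∑ b, wedge (oneForm (Ω a b y)) (oneForm (Θ b y))) (a : Fin 4) :
    ∑ b, wedge (extDeriv (fun y => oneForm (Ω a b y)) x +
      ∑ c, wedge (oneForm (Ω a c x)) (oneForm (Ω c b x))) (oneForm (Θ b x)) = 0 := by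
  have hΘ' : ∀ a, DifferentiableAt ℝ (Θ a) x := fun a => (hΘ a).differentiableAt two_ne_zero
  have hdd : extDeriv (extDeriv fun y => oneForm (Θ a y)) x = 0 :=
    extDeriv_extDeriv_apply (contDiffAt_oneForm (hΘ a)) (by simp)
  have hev : extDeriv (fun y => oneForm (Θ a y)) =ᶠ[𝓝 x]
      fun y => ∑ b, (-1 : ℝ) • wedge (oneForm (Ω a b y)) (oneForm (Θ b y)) := by
    filter_upwards [hstr a] with y hy
    rw [hy, ← Finset.smul_sum, neg_one_smul]
  rw [hev.extDeriv_eq, extDeriv_sum_smul Finset.univ (fun _ : Fin 4 => (-1 : ℝ))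
    fun b _ => differentiableAt_wedge (hΩ a b) (hΘ' b), ← Finset.smul_sum, neg_one_smul,
    neg_eq_zero] at hdd
  rw [← hdd]
  have hstr' := fun b => (hstr b).self_of_nhds
  simp only [extDeriv_wedge (hΩ a _) (hΘ' _), hstr', wedge_neg_right, wedge_sum_right,
    wedge_add_left, wedge_sum_left, Finset.sum_add_distrib, sub_neg_eq_add, wedge_assoc_one]
  rw [Finset.sum_comm]

/-- Exterior derivative of the `2`-form `½ Ω_ab ∧ ⋆(Θ^a ∧ Θ^b ∧ Θ^c)` whose Hodge dual is, up to
sign, the superpotential. -/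
lemma extDeriv_superpotential (hΘ : ∀ a, DifferentiableAt ℝ (Θ a) x)
    (hΩ : ∀ a b, DifferentiableAt ℝ (Ω a b) x)
    (hstr : ∀ a, extDeriv (fun y => oneForm (Θ a y)) x =
      -∑ b, wedge (oneForm (Ω a b x)) (oneForm (Θ b x))) (c : Fin 4) :
    extDeriv (fun y => (1 / 2 : ℝ) • ∑ a, ∑ b, wedge (eta a • oneForm (Ω a b y))
      (starTriple (fun d => oneForm (Θ d y)) a b c)) x =
    (1 / 2 : ℝ) • ∑ a, ∑ b, eta a • (wedge (extDeriv (fun y => oneForm (Ω a b y)) x)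
      (starTriple (fun d => oneForm (Θ d x)) a b c) + wedge (oneForm (Ω a b x))
        (∑ d, starComp a b c d • ∑ m, wedge (oneForm (Ω d m x)) (oneForm (Θ m x)))) := by
  have h : ∀ y, (1 / 2 : ℝ) • ∑ a, ∑ b, wedge (eta a • oneForm (Ω a b y))
      (starTriple (fun d => oneForm (Θ d y)) a b c) =
      ∑ i : Fin 4 × Fin 4 × Fin 4, (1 / 2 * (eta i.1 * starComp i.1 i.2.1 c i.2.2)) •
        wedge (oneForm (Ω i.1 i.2.1 y)) (oneForm (Θ i.2.2 y)) := fun y => by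
    simp only [starTriple, wedge_sum_right, wedge_smul_left, wedge_smul_right,
      Fintype.sum_prod_type, Finset.smul_sum, smul_smul]
    simp only [mul_comm]
  simp only [h]
  rw [extDeriv_sum_smul _ _ fun i _ => differentiableAt_wedge (hΩ i.1 i.2.1) (hΘ i.2.2)]
  simp only [Fintype.sum_prod_type, extDeriv_wedge (hΩ _ _) (hΘ _), hstr, wedge_neg_right,
    starTriple, wedge_sum_right, wedge_smul_right, smul_add, Finset.smul_sum, smul_smul,
    sub_neg_eq_add, Finset.sum_add_distrib]

section Frame

variable {X : Fin 4 → E → E}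

/-- The coframe dual to a frame is as smooth as the frame. -/
lemma contDiffAt_coframe [CompleteSpace E] {n : WithTop ℕ∞} (hX : ∀ a, ContDiffAt ℝ n (X a) x)
    (hd : ∀ᶠ y in 𝓝 x, ∀ a b, Θ a y (X b y) = if a = b then 1 else 0)
    (hs : ∀ᶠ y in 𝓝 x, ∀ v, v = ∑ a, Θ a y v • X a y) (a : Fin 4) : ContDiffAt ℝ n (Θ a) x := by
  -- The frame at `y`, as an isomorphism `ℝ⁴ → E`; the coframe consists of the rows of its inverse.
  let A : E → (Fin 4 → ℝ) →L[ℝ] E := fun y =>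
    ∑ b, (ContinuousLinearMap.proj b : (Fin 4 → ℝ) →L[ℝ] ℝ).smulRight (X b y)
  have hA : ContDiffAt ℝ n A x := ContDiffAt.sum fun b _ =>
    (ContinuousLinearMap.smulRightL ℝ (Fin 4 → ℝ) E
      (ContinuousLinearMap.proj b)).contDiff.contDiffAt.comp x (hX b)
  have hAe : ∀ᶠ y in 𝓝 x, ∃ L : (Fin 4 → ℝ) ≃L[ℝ] E, A y = L ∧ ∀ v, L.symm v a = Θ a y v := by
    filter_upwards [hd, hs] with y hd hs
    refine ⟨ContinuousLinearEquiv.equivOfInverse (A y) (ContinuousLinearMap.pi fun b => Θ b y)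
      (fun w => ?_) (fun v => ?_), rfl, fun v => rfl⟩
    · ext b
      simp [A, hd]
    · simp [A, ← hs]
  obtain ⟨L, hL, -⟩ := hAe.self_of_nhds
  have hinv : ContDiffAt ℝ n (fun y => (A y).inverse) x := by
    refine ContDiffAt.comp (g := ContinuousLinearMap.inverse) x ?_ hA
    rw [hL]
    exact contDiffAt_map_inverse L
  have hproj : ContDiffAt ℝ n (fun y => (ContinuousLinearMap.proj a : (Fin 4 → ℝ) →L[ℝ] ℝ).comp
      (A y).inverse) x := contDiffAt_const.clm_comp hinv
  refine hproj.congr_of_eventuallyEq ?_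
  filter_upwards [hAe] with y ⟨L, hL, hΘ⟩
  ext v
  simp [hL, hΘ]

/-- Cartan's first structure equation for a torsion-free connection, from the brackets of the
frame fields. -/
lemma extDeriv_coframe (hΘ : ∀ a, DifferentiableAt ℝ (Θ a) x) (hX : ∀ a, DifferentiableAt ℝ (X a) x)
    (hd : ∀ᶠ y in 𝓝 x, ∀ a b, Θ a y (X b y) = if a = b then 1 else 0)
    (hs : ∀ v, v = ∑ a, Θ a x v • X a x)
    (hbr : ∀ a b c, Θ a x (VectorField.lieBracket ℝ (X b) (X c) x) =
      Ω a c x (X b x) - Ω a b x (X c x)) (a : Fin 4) :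
    extDeriv (fun y => oneForm (Θ a y)) x =
      -∑ b, wedge (oneForm (Ω a b x)) (oneForm (Θ b x)) := by
  refine form_ext_two hs fun b c => ?_
  -- Differentiating `Θ^a(X_b) = δ^a_b` moves the derivative from `Θ^a` to `X_b`.
  have hconst : ∀ b, HasFDerivAt (fun y => Θ a y (X b y)) (0 : E →L[ℝ] ℝ) x := fun b => by
    refine (hasFDerivAt_const (if a = b then (1 : ℝ) else 0) x).congr_of_eventuallyEq ?_
    filter_upwards [hd] with y hy using hy a b
  have hleib : ∀ b v, fderiv ℝ (Θ a) x v (X b x) = -Θ a x (fderiv ℝ (X b) x v) := fun b v => by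
    have h := ((hΘ a).hasFDerivAt.clm_apply (hX b).hasFDerivAt).unique (hconst b)
    have := congrArg (fun L : E →L[ℝ] ℝ => L v) h
    simp at this
    linarith
  have hb := hbr a b c
  rw [VectorField.lieBracket, map_sub] at hb
  rw [extDeriv_oneForm_apply (hΘ a), ContinuousAlternatingMap.neg_apply,
    ContinuousAlternatingMap.sum_apply]
  have hw : ∀ d, wedge (oneForm (Ω a d x)) (oneForm (Θ d x)) ![X b x, X c x] =
      Ω a d x (X b x) * (if d = c then 1 else 0) - Ω a d x (X c x) * (if d = b then 1 else 0) := by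
    intro d
    rw [← hd.self_of_nhds d c, ← hd.self_of_nhds d b]
    erw [wedge_one_one]
    rfl
  erw [Finset.sum_congr rfl fun d _ => hw d]
  simp [hleib, Finset.sum_sub_distrib]
  linarith

/-- Regularity of a metric torsion-free connection: Koszul's formula expresses its forms through
the brackets of the frame fields. -/
lemma differentiableAt_connection (hΘ : ∀ a, DifferentiableAt ℝ (Θ a) x)
    (hX : ∀ a, ContDiffAt ℝ 2 (X a) x)
    (hs : ∀ᶠ y in 𝓝 x, ∀ v, v = ∑ a, Θ a y v • X a y)
    (hmetric : ∀ᶠ y in 𝓝 x, ∀ a b, eta a • Ω a b y = -(eta b • Ω b a y))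
    (hbr : ∀ᶠ y in 𝓝 x, ∀ a b c, Θ a y (VectorField.lieBracket ℝ (X b) (X c) y) =
      Ω a c y (X b y) - Ω a b y (X c y)) (a b : Fin 4) : DifferentiableAt ℝ (Ω a b) x := by
  -- `K a b c` is `g(X_a, [X_b, X_c])`.
  let K : Fin 4 → Fin 4 → Fin 4 → E → ℝ := fun a b c y =>
    eta a * Θ a y (VectorField.lieBracket ℝ (X b) (X c) y)
  have hK : ∀ a b c, DifferentiableAt ℝ (K a b c) x := by
    intro a b c
    have hX1 : ∀ a, DifferentiableAt ℝ (X a) x := fun a => (hX a).differentiableAt two_ne_zero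
    have hX2 : ∀ a, DifferentiableAt ℝ (fderiv ℝ (X a)) x := fun a =>
      ((hX a).fderiv_right (m := 1) (by norm_num)).differentiableAt one_ne_zero
    exact ((hΘ a).clm_apply
      (((hX2 c).clm_apply (hX1 b)).sub ((hX2 b).clm_apply (hX1 c)))).const_mul _
  have hΩ : Ω a b =ᶠ[𝓝 x] fun y =>
      ∑ c, (-(1 / 2) * eta a * (K a b c y + K b c a y - K c a b y)) • Θ c y := by
    filter_upwards [hs, hmetric, hbr] with y hs hm hb
    have hm' : ∀ a b v, eta a * Ω a b y v = -(eta b * Ω b a y v) := fun a b v => by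
      simpa using congrArg (fun L : E →L[ℝ] ℝ => L v) (hm a b)
    have heta : eta a * eta a = 1 := by unfold eta; split_ifs <;> norm_num
    -- Koszul's formula in a frame with constant products `g(X_a, X_b)`.
    have hc : ∀ c, Ω a b y (X c y) =
        -(1 / 2) * eta a * (K a b c y + K b c a y - K c a b y) := fun c => by
      simp only [K, hb, mul_sub]
      have h1 := hm' a b (X c y)
      have h2 := hm' b c (X a y)
      have h3 := hm' c a (X b y)
      linear_combination (1 / 2 * eta a) * h1 - (1 / 2 * eta a) * h2 + (1 / 2 * eta a) * h3 -
        Ω a b y (X c y) * heta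
    ext v
    conv_lhs => rw [hs v]
    simp [hc, mul_comm]
  refine DifferentiableAt.congr_of_eventuallyEq ?_ hΩ
  exact DifferentiableAt.fun_sum fun c _ =>
    ((((hK a b c).add (hK b c a)).sub (hK c a b)).const_mul _).smul (hΘ c)

end Frame

end FlatForms

/-! ### Tetrads in the preferred chart -/

section Chart
variable {M : Type*} [TopologicalSpace M] [ChartedSpace R4 M]

lemma mlieBracket_eq_lieBracket (V W : (y : R4) → TangentSpace 𝓘(ℝ, R4) y) :
    VectorField.mlieBracket 𝓘(ℝ, R4) V W = VectorField.lieBracket ℝ V W := by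
  rw [← VectorField.mlieBracketWithin_univ, VectorField.mlieBracketWithin_eq_lieBracketWithin]
  exact VectorField.lieBracketWithin_univ

lemma contMDiffAt_chart_symm [IsManifold (𝓡 4) ∞ M] (x : M) {y : R4}
    (hy : y ∈ (extChartAt (𝓡 4) x).target) :
    ContMDiffAt 𝓘(ℝ, R4) (𝓡 4) ∞ (extChartAt (𝓡 4) x).symm y :=
  (contMDiffOn_extChartAt_symm x).contMDiffAt ((isOpen_extChartAt_target x).mem_nhds hy)

lemma isInvertible_mfderiv_chart_symm [IsManifold (𝓡 4) ∞ M] (x : M) {y : R4}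
    (hy : y ∈ (extChartAt (𝓡 4) x).target) :
    (mfderiv 𝓘(ℝ, R4) (𝓡 4) (extChartAt (𝓡 4) x).symm y).IsInvertible := by
  have := isInvertible_mfderivWithin_extChartAt_symm hy
  rwa [ModelWithCorners.range_eq_univ, mfderivWithin_univ] at this

lemma mfderiv_symm_comp_mfderiv_chart [IsManifold (𝓡 4) ∞ M] (x : M) :
    (mfderiv 𝓘(ℝ, R4) (𝓡 4) (extChartAt (𝓡 4) x).symm (extChartAt (𝓡 4) x x)).comp
      (mfderiv (𝓡 4) 𝓘(ℝ, R4) (extChartAt (𝓡 4) x) x) = ContinuousLinearMap.id ℝ _ := by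
  have := mfderivWithin_extChartAt_symm_comp_mfderiv_extChartAt' (I := 𝓡 4)
    (mem_extChartAt_source (I := 𝓡 4) x)
  rwa [ModelWithCorners.range_eq_univ, mfderivWithin_univ] at this

/-- A field of forms read in the preferred chart at `x`. -/
def chartForm {k : ℕ} (x : M) (α : FormField M k) : R4 → R4 [⋀^Fin k]→L[ℝ] ℝ := fun y =>
  (α ((extChartAt (𝓡 4) x).symm y)).compContinuousLinearMap
      (mfderiv 𝓘(ℝ, R4) (𝓡 4) (extChartAt (𝓡 4) x).symm y)

lemma extD_eq {k : ℕ} (α : FormField M k) (x : M) :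
    extD α x = (extDeriv (chartForm x α) (extChartAt (𝓡 4) x x)).compContinuousLinearMap
      (mfderiv (𝓡 4) 𝓘(ℝ, R4) (extChartAt (𝓡 4) x) x) := rfl

lemma chartForm_comp [IsManifold (𝓡 4) ∞ M] {k : ℕ} (α : FormField M k) (x : M) :
    (chartForm x α (extChartAt (𝓡 4) x x)).compContinuousLinearMap
      (mfderiv (𝓡 4) 𝓘(ℝ, R4) (extChartAt (𝓡 4) x) x) = α x := by
  have h := mfderiv_symm_comp_mfderiv_chart x
  have hx := extChartAt_to_inv (I := 𝓡 4) x
  have key : ∀ z : M, z = x → ∀ Q : R4 →L[ℝ] R4, Q = ContinuousLinearMap.id ℝ R4 →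
      (α z : R4 [⋀^Fin k]→L[ℝ] ℝ).compContinuousLinearMap Q = α x := by
    rintro z rfl Q rfl
    rfl
  exact key _ hx _ h

lemma eventually_chart {U : Set M} (hU : IsOpen U) {x : M} (hx : x ∈ U) :
    ∀ᶠ y in 𝓝 (extChartAt (𝓡 4) x x), y ∈ (extChartAt (𝓡 4) x).target ∧
      (extChartAt (𝓡 4) x).symm y ∈ U := by
  have hc := continuousAt_extChartAt_symm (I := 𝓡 4) x
  have hU' : U ∈ 𝓝 ((extChartAt (𝓡 4) x).symm (extChartAt (𝓡 4) x x)) :=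
    hU.mem_nhds (by rwa [extChartAt_to_inv])
  filter_upwards [extChartAt_target_mem_nhds (I := 𝓡 4) x, hc hU'] with y h1 h2 using ⟨h1, h2⟩

end Chart

namespace OrthonormalTetrad
variable {M : Type*} [TopologicalSpace M] [ChartedSpace R4 M] [IsManifold (𝓡 4) ∞ M]
  {g : LorentzianMetric M} {U : Set M} (t : OrthonormalTetrad g U) {D : LinearConnection M}

lemma mdifferentiableAt_e (hU : IsOpen U) {z : M} (hz : z ∈ U) (a : Fin 4) :
    MDifferentiableAt (𝓡 4) ((𝓡 4).prod 𝓘(ℝ, R4))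
      (fun x => Bundle.TotalSpace.mk' R4 x (t.e a x)) z :=
  ((t.smooth_e a).contMDiffAt (hU.mem_nhds hz)).mdifferentiableAt (by simp)

lemma eq_sum {z : M} (hz : z ∈ U) (v : TangentSpace (𝓡 4) z) : v = ∑ a, t.θ a z v • t.e a z :=
  eq_sum_of_dual (V := TangentSpace (𝓡 4) z) (finrank_euclideanSpace_fin (𝕜 := ℝ) (n := 4))
    (t.dual z hz) v

/-- `ω_ab = -ω_ba`, by differentiating `g(e_a, e_b) = η_ab`. -/
lemma connLow_antisymm (hD : IsLeviCivita g D) (hU : IsOpen U) {z : M} (hz : z ∈ U) (a b : Fin 4)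
    (v : TangentSpace (𝓡 4) z) :
    eta a * t.θ a z (D (t.e b) z v) = -(eta b * t.θ b z (D (t.e a) z v)) := by
  have h := hD.metric z (t.e a) (t.e b) (t.mdifferentiableAt_e hU hz a)
    (t.mdifferentiableAt_e hU hz b) v
  have h0 : mvfderiv (𝓡 4) (fun y => g.val y (t.e a y) (t.e b y)) z v = 0 := by
    have hev : (fun y => g.val y (t.e a y) (t.e b y)) =ᶠ[𝓝 z]
        fun _ => if a = b then eta a else 0 := by
      filter_upwards [hU.mem_nhds hz] with y hy using t.orthonormal y hy a b
    have hm : mfderiv (𝓡 4) 𝓘(ℝ, ℝ) (fun y => g.val y (t.e a y) (t.e b y)) z = 0 :=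
      hev.mfderiv_eq.trans mfderiv_const
    rw [mvfderiv, hm, ContinuousLinearMap.comp_zero]
    rfl
  rw [h0] at h
  have hg : ∀ (a : Fin 4) (w : TangentSpace (𝓡 4) z), g.val z (t.e a z) w = eta a * t.θ a z w := by
    intro a w
    conv_lhs => rw [t.eq_sum hz w]
    simp [t.orthonormal z hz, mul_comm]
  rw [g.symm, hg, hg] at h
  linarith

/-- The frame field `e_a` read in the preferred chart at `x`. -/
def chartFrame (x : M) (a : Fin 4) : R4 → R4 :=
  VectorField.mpullback 𝓘(ℝ, R4) (𝓡 4) (extChartAt (𝓡 4) x).symm (t.e a)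

/-- The coframe field `θ^a` read in the preferred chart at `x`. -/
def chartCoframe (x : M) (a : Fin 4) : R4 → R4 →L[ℝ] ℝ := fun y =>
  (t.θ a ((extChartAt (𝓡 4) x).symm y)).comp
    (mfderiv 𝓘(ℝ, R4) (𝓡 4) (extChartAt (𝓡 4) x).symm y)

variable (D) in
/-- The connection form `ω^a_b` read in the preferred chart at `x`. -/
def chartConn (x : M) (a b : Fin 4) : R4 → R4 →L[ℝ] ℝ := fun y =>
  ((t.θ a ((extChartAt (𝓡 4) x).symm y)).comp (D (t.e b) ((extChartAt (𝓡 4) x).symm y))).comp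
    (mfderiv 𝓘(ℝ, R4) (𝓡 4) (extChartAt (𝓡 4) x).symm y)

lemma chartForm_conn (x : M) (a b : Fin 4) :
    chartForm x (t.conn D a b) = fun y => oneForm (t.chartConn D x a b y) := rfl

variable {x : M} {y : R4}

lemma mfderiv_chartFrame (hy : y ∈ (extChartAt (𝓡 4) x).target)
    (a : Fin 4) :
    mfderiv 𝓘(ℝ, R4) (𝓡 4) (extChartAt (𝓡 4) x).symm y (t.chartFrame x a y) =
      t.e a ((extChartAt (𝓡 4) x).symm y) :=
  (isInvertible_mfderiv_chart_symm x hy).self_apply_inverse _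

lemma chart_dual (hy : y ∈ (extChartAt (𝓡 4) x).target)
    (hyU : (extChartAt (𝓡 4) x).symm y ∈ U) (a b : Fin 4) :
    t.chartCoframe x a y (t.chartFrame x b y) = if a = b then 1 else 0 :=
  (congrArg (t.θ a _) (t.mfderiv_chartFrame hy b)).trans (t.dual _ hyU a b)

lemma chart_eq_sum (hy : y ∈ (extChartAt (𝓡 4) x).target)
    (hyU : (extChartAt (𝓡 4) x).symm y ∈ U) (v : R4) :
    v = ∑ a, t.chartCoframe x a y v • t.chartFrame x a y :=
  eq_sum_of_dual finrank_euclideanSpace_fin (t.chart_dual hy hyU) v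

lemma contDiffAt_chartFrame (hU : IsOpen U) (hy : y ∈ (extChartAt (𝓡 4) x).target)
    (hyU : (extChartAt (𝓡 4) x).symm y ∈ U) (a : Fin 4) :
    ContDiffAt ℝ 2 (t.chartFrame x a) y := by
  have h : ContMDiffAt (𝓡 4) ((𝓡 4).prod 𝓘(ℝ, R4)) 2
      (fun x => Bundle.TotalSpace.mk' R4 x (t.e a x)) ((extChartAt (𝓡 4) x).symm y) :=
    ((t.smooth_e a).contMDiffAt (hU.mem_nhds hyU)).of_le (by norm_cast)
  exact contMDiffAt_vectorSpace_iff_contDiffAt.1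
    (h.mpullback_vectorField_preimage (n := 3) ((contMDiffAt_chart_symm x hy).of_le (by norm_cast))
      (isInvertible_mfderiv_chart_symm x hy) (by norm_num))

/-- Vanishing of the torsion on a pair of frame fields, in the chart at `x`. -/
lemma chartCoframe_lieBracket (hD : IsLeviCivita g D) (hU : IsOpen U)
    (hy : y ∈ (extChartAt (𝓡 4) x).target) (hyU : (extChartAt (𝓡 4) x).symm y ∈ U)
    (a b c : Fin 4) :
    t.chartCoframe x a y (VectorField.lieBracket ℝ (t.chartFrame x b) (t.chartFrame x c) y) =
      t.chartConn D x a c y (t.chartFrame x b y) - t.chartConn D x a b y (t.chartFrame x c y) := by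
  have hb := t.mdifferentiableAt_e hU hyU b
  have hc := t.mdifferentiableAt_e hU hyU c
  have htor := (CovariantDerivative.torsion_eq_zero_iff D).1 hD.torsion_eq_zero hb hc
  have : IsManifold (𝓡 4) (minSmoothness ℝ 2) M := by
    rw [minSmoothness_of_isRCLikeNormedField]
    infer_instance
  have hpull := VectorField.mpullback_mlieBracket (I := 𝓘(ℝ, R4)) (n := ∞) hb hc
    (contMDiffAt_chart_symm x hy) (by rw [minSmoothness_of_isRCLikeNormedField]; norm_cast)
  replace hpull := hpull.trans (congrFun (mlieBracket_eq_lieBracket _ _) y)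
  have hmf : mfderiv 𝓘(ℝ, R4) (𝓡 4) (extChartAt (𝓡 4) x).symm y
      (VectorField.lieBracket (E := R4) ℝ (t.chartFrame x b) (t.chartFrame x c) y) =
      VectorField.mlieBracket (𝓡 4) (t.e b) (t.e c) ((extChartAt (𝓡 4) x).symm y) :=
    (congrArg (mfderiv 𝓘(ℝ, R4) (𝓡 4) (extChartAt (𝓡 4) x).symm y) hpull.symm).trans
      ((isInvertible_mfderiv_chart_symm x hy).self_apply_inverse _)
  have h1 : ∀ a b c, t.chartConn D x a c y (t.chartFrame x b y) =
      t.θ a _ (D (t.e c) _ (t.e b ((extChartAt (𝓡 4) x).symm y))) := fun a b c =>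
    congrArg (fun w => t.θ a _ (D (t.e c) _ w)) (t.mfderiv_chartFrame hy b)
  rw [h1, h1, ← map_sub, htor]
  exact congrArg (t.θ a _) hmf

lemma chartConn_antisymm (hD : IsLeviCivita g D) (hU : IsOpen U)
    (hyU : (extChartAt (𝓡 4) x).symm y ∈ U) (a b : Fin 4) :
    eta a • t.chartConn D x a b y = -(eta b • t.chartConn D x b a y) := by
  ext v
  exact t.connLow_antisymm hD hU hyU a b _

end OrthonormalTetrad

/-! ### The superpotential identity -/

/-- The curvature forms of a metric connection are antisymmetric. -/
lemma curvature_antisymm {E : Type*} [NormedAddCommGroup E] [NormedSpace ℝ E]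
    {Ω : Fin 4 → Fin 4 → E → E →L[ℝ] ℝ} {x : E}
    (hm : ∀ᶠ y in 𝓝 x, ∀ a b, eta a • Ω a b y = -(eta b • Ω b a y)) (a b : Fin 4) :
    eta b • (extDeriv (fun y => oneForm (Ω b a y)) x +
      ∑ c, wedge (oneForm (Ω b c x)) (oneForm (Ω c a x))) =
    -(eta a • (extDeriv (fun y => oneForm (Ω a b y)) x +
      ∑ c, wedge (oneForm (Ω a c x)) (oneForm (Ω c b x)))) := by
  have hm' : ∀ a b, eta a • oneForm (Ω a b x) = -(eta b • oneForm (Ω b a x)) := fun a b => by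
    ext v
    exact congrArg (fun L : E →L[ℝ] ℝ => L (v 0)) (hm.self_of_nhds a b)
  have hd : eta b • extDeriv (fun y => oneForm (Ω b a y)) x =
      -eta a • extDeriv (fun y => oneForm (Ω a b y)) x := by
    refine (extDeriv_smul _ _).symm.trans (Eq.trans ?_ (extDeriv_smul _ _))
    refine EventuallyEq.extDeriv_eq ?_
    filter_upwards [hm] with y hy
    ext v
    have := congrArg (fun L : E →L[ℝ] ℝ => L (v 0)) (hy b a)
    exact this.trans (neg_mul _ _).symm
  have hq : ∀ c, eta b • wedge (oneForm (Ω b c x)) (oneForm (Ω c a x)) =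
      -(eta a • wedge (oneForm (Ω a c x)) (oneForm (Ω c b x))) := fun c => by
    rw [← wedge_smul_left, hm', wedge_neg_left, wedge_smul_left, ← wedge_smul_right, hm',
      wedge_neg_right, wedge_smul_right, wedge_one_anticomm]
    simp
  rw [smul_add, hd, Finset.smul_sum, smul_add, Finset.smul_sum, neg_add,
    neg_smul, ← Finset.sum_neg_distrib]
  simp only [hq]

section Pullback

variable {V W : Type*} [AddCommGroup V] [Module ℝ V] [TopologicalSpace V]
  [AddCommGroup W] [Module ℝ W] [TopologicalSpace W]

lemma sum_compContinuousLinearMap {ι : Type*} (s : Finset ι) {n : ℕ}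
    (F : ι → V [⋀^Fin n]→L[ℝ] ℝ) (L : W →L[ℝ] V) :
    (∑ i ∈ s, F i).compContinuousLinearMap L = ∑ i ∈ s, (F i).compContinuousLinearMap L := by
  ext v
  simp only [ContinuousAlternatingMap.compContinuousLinearMap_apply,
    ContinuousAlternatingMap.sum_apply]

lemma smul_compContinuousLinearMap {n : ℕ} (r : ℝ) (F : V [⋀^Fin n]→L[ℝ] ℝ) (L : W →L[ℝ] V) :
    (r • F).compContinuousLinearMap L = r • F.compContinuousLinearMap L := rfl

lemma add_compContinuousLinearMap {n : ℕ} (F G : V [⋀^Fin n]→L[ℝ] ℝ) (L : W →L[ℝ] V) :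
    (F + G).compContinuousLinearMap L =
      F.compContinuousLinearMap L + G.compContinuousLinearMap L := rfl

lemma starTriple_compContinuousLinearMap (θ : Fin 4 → V [⋀^Fin 1]→L[ℝ] ℝ) (a b c : Fin 4)
    (L : W →L[ℝ] V) : (starTriple θ a b c).compContinuousLinearMap L =
      starTriple (fun d => (θ d).compContinuousLinearMap L) a b c := by
  simp only [starTriple, sum_compContinuousLinearMap, smul_compContinuousLinearMap]

/-- Naturality of the `2`-form `½ ω_ab ∧ ⋆(θ^a ∧ θ^b ∧ θ^c)`. -/
lemma superpotential_compContinuousLinearMap (θ : Fin 4 → V [⋀^Fin 1]→L[ℝ] ℝ)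
    (Ω : Fin 4 → Fin 4 → V [⋀^Fin 1]→L[ℝ] ℝ) (c : Fin 4) (L : W →L[ℝ] V) :
    ((1 / 2 : ℝ) • ∑ a, ∑ b, wedge (eta a • Ω a b)
      (starTriple θ a b c)).compContinuousLinearMap L =
    (1 / 2 : ℝ) • ∑ a, ∑ b, wedge (eta a • (Ω a b).compContinuousLinearMap L)
      (starTriple (fun d => (θ d).compContinuousLinearMap L) a b c) := by
  simp only [smul_compContinuousLinearMap, sum_compContinuousLinearMap,
    wedge_compContinuousLinearMap, starTriple_compContinuousLinearMap]

/-- Naturality of the exterior derivative of the `2`-form `½ ω_ab ∧ ⋆(θ^a ∧ θ^b ∧ θ^c)`. -/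
lemma extDeriv_superpotential_compContinuousLinearMap (θ : Fin 4 → V [⋀^Fin 1]→L[ℝ] ℝ)
    (Ω : Fin 4 → Fin 4 → V [⋀^Fin 1]→L[ℝ] ℝ) (F : Fin 4 → Fin 4 → V [⋀^Fin 2]→L[ℝ] ℝ)
    (c : Fin 4) (L : W →L[ℝ] V) :
    ((1 / 2 : ℝ) • ∑ a, ∑ b, eta a • (wedge (F a b) (starTriple θ a b c) +
      wedge (Ω a b) (∑ d, starComp a b c d • ∑ m, wedge (Ω d m) (θ m)) :
        V [⋀^Fin 3]→L[ℝ] ℝ)).compContinuousLinearMap L =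
    (1 / 2 : ℝ) • ∑ a, ∑ b, eta a • (wedge ((F a b).compContinuousLinearMap L)
      (starTriple (fun d => (θ d).compContinuousLinearMap L) a b c) +
      wedge ((Ω a b).compContinuousLinearMap L) (∑ d, starComp a b c d • ∑ m,
        wedge ((Ω d m).compContinuousLinearMap L) ((θ m).compContinuousLinearMap L))) := by
  simp only [smul_compContinuousLinearMap, sum_compContinuousLinearMap,
    ← starTriple_compContinuousLinearMap, ← wedge_compContinuousLinearMap]
  refine congrArg (fun A => (1 / 2 : ℝ) • A) (Finset.sum_congr rfl fun a _ =>
    Finset.sum_congr rfl fun b _ => congrArg (fun A => eta a • A) ?_)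
  refine (add_compContinuousLinearMap _ _ _).trans (congrArg (fun A => _ + A) ?_)
  refine (wedge_compContinuousLinearMap _ _ _).trans (congrArg (wedge _) ?_)
  simp only [sum_compContinuousLinearMap, smul_compContinuousLinearMap]

end Pullback

namespace OrthonormalTetrad
variable {M : Type*} [TopologicalSpace M] [ChartedSpace R4 M] [IsManifold (𝓡 4) ∞ M]
  {g : LorentzianMetric M} {U : Set M} (t : OrthonormalTetrad g U) {D : LinearConnection M}

lemma contDiffAt_chartCoframe (hU : IsOpen U) {x : M} {y : R4}
    (hy : ∀ᶠ z in 𝓝 y, z ∈ (extChartAt (𝓡 4) x).target ∧ (extChartAt (𝓡 4) x).symm z ∈ U)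
    (a : Fin 4) : ContDiffAt ℝ 2 (t.chartCoframe x a) y :=
  contDiffAt_coframe
    (fun a => t.contDiffAt_chartFrame hU hy.self_of_nhds.1 hy.self_of_nhds.2 a)
    (hy.mono fun _ hz => t.chart_dual hz.1 hz.2) (hy.mono fun _ hz => t.chart_eq_sum hz.1 hz.2) a

lemma differentiableAt_chartConn (hD : IsLeviCivita g D) (hU : IsOpen U) {x : M} (hx : x ∈ U)
    (a b : Fin 4) : DifferentiableAt ℝ (t.chartConn D x a b) (extChartAt (𝓡 4) x x) := by
  have hev := eventually_chart hU hx
  exact differentiableAt_connection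
    (fun a => (t.contDiffAt_chartCoframe hU hev a).differentiableAt two_ne_zero)
    (fun a => t.contDiffAt_chartFrame hU hev.self_of_nhds.1 hev.self_of_nhds.2 a)
    (hev.mono fun _ hz => t.chart_eq_sum hz.1 hz.2)
    (hev.mono fun _ hz => t.chartConn_antisymm hD hU hz.2)
    (hev.mono fun _ hz => t.chartCoframe_lieBracket hD hU hz.1 hz.2) a b

/-- First structure equation `dθ^a = -ω^a_b ∧ θ^b`, in the chart at `x`. -/
lemma extDeriv_chartCoframe (hD : IsLeviCivita g D) (hU : IsOpen U) {x : M} (hx : x ∈ U)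
    (a : Fin 4) : ∀ᶠ y in 𝓝 (extChartAt (𝓡 4) x x),
      extDeriv (fun y => oneForm (t.chartCoframe x a y)) y =
        -∑ b, wedge (oneForm (t.chartConn D x a b y)) (oneForm (t.chartCoframe x b y)) := by
  filter_upwards [(eventually_chart hU hx).eventually_nhds] with y hy
  obtain ⟨h1, h2⟩ := hy.self_of_nhds
  exact extDeriv_coframe
    (fun a => (t.contDiffAt_chartCoframe hU hy a).differentiableAt two_ne_zero)
    (fun a => (t.contDiffAt_chartFrame hU h1 h2 a).differentiableAt two_ne_zero)
    (hy.mono fun _ hz => t.chart_dual hz.1 hz.2) (t.chart_eq_sum h1 h2)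
    (t.chartCoframe_lieBracket hD hU h1 h2) a

/-- The curvature forms at `x`, computed in the chart at `x`. -/
lemma curv_eq (x : M) (a b : Fin 4) : t.curv D a b x =
    (extDeriv (fun y => oneForm (t.chartConn D x a b y)) (extChartAt (𝓡 4) x x) +
      ∑ c, wedge (oneForm (t.chartConn D x a c (extChartAt (𝓡 4) x x)))
        (oneForm (t.chartConn D x c b (extChartAt (𝓡 4) x x)))).compContinuousLinearMap
      (mfderiv (𝓡 4) 𝓘(ℝ, R4) (extChartAt (𝓡 4) x) x) := by
  -- Write each `ω` at `x` as the pullback of its expression in the chart.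
  have h : t.curv D a b x = extD (t.conn D a b) x +
      ∑ c, wedge ((chartForm x (t.conn D a c) (extChartAt (𝓡 4) x x)).compContinuousLinearMap
        (mfderiv (𝓡 4) 𝓘(ℝ, R4) (extChartAt (𝓡 4) x) x))
        ((chartForm x (t.conn D c b) (extChartAt (𝓡 4) x x)).compContinuousLinearMap
        (mfderiv (𝓡 4) 𝓘(ℝ, R4) (extChartAt (𝓡 4) x) x)) := by
    simp only [chartForm_comp]
    rfl
  rw [h, extD_eq]
  simp only [chartForm_conn]
  ext v
  rfl

lemma coframe_eq (x : M) (a : Fin 4) : t.coframe a x =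
    (oneForm (t.chartCoframe x a (extChartAt (𝓡 4) x x))).compContinuousLinearMap
      (mfderiv (𝓡 4) 𝓘(ℝ, R4) (extChartAt (𝓡 4) x) x) :=
  (chartForm_comp (t.coframe a) x).symm

lemma conn_eq (x : M) (a b : Fin 4) : t.conn D a b x =
    (oneForm (t.chartConn D x a b (extChartAt (𝓡 4) x x))).compContinuousLinearMap
      (mfderiv (𝓡 4) 𝓘(ℝ, R4) (extChartAt (𝓡 4) x) x) :=
  (chartForm_comp (t.conn D a b) x).symm

/-- First Bianchi identity `ℛ_ab ∧ θ^b = 0`. -/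
lemma sum_curvLow_wedge_coframe (hD : IsLeviCivita g D) (hU : IsOpen U) {x : M} (hx : x ∈ U)
    (a : Fin 4) : ∑ b, wedge (t.curvLow D a b x) (t.coframe b x) = 0 := by
  have hB := first_bianchi (fun a => t.contDiffAt_chartCoframe hU (eventually_chart hU hx) a)
    (t.differentiableAt_chartConn hD hU hx) (t.extDeriv_chartCoframe hD hU hx) a
  have h1 : ∀ b, wedge (t.curvLow D a b x) (t.coframe b x) =
      eta a • (wedge (extDeriv (fun y => oneForm (t.chartConn D x a b y)) (extChartAt (𝓡 4) x x) +
      ∑ c, wedge (oneForm (t.chartConn D x a c (extChartAt (𝓡 4) x x)))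
        (oneForm (t.chartConn D x c b (extChartAt (𝓡 4) x x))))
        (oneForm (t.chartCoframe x b (extChartAt (𝓡 4) x x)))).compContinuousLinearMap
      (mfderiv (𝓡 4) 𝓘(ℝ, R4) (extChartAt (𝓡 4) x) x) := fun b => by
    rw [curvLow, curv_eq, coframe_eq, wedge_smul_left]
    exact congrArg (fun A => eta a • A) (wedge_compContinuousLinearMap _ _ _).symm
  rw [Finset.sum_congr rfl fun b _ => h1 b, ← Finset.smul_sum]
  refine (congrArg (fun A => eta a • A) ((sum_compContinuousLinearMap _ _ _).symm.trans
    (congrArg (fun A : R4 [⋀^Fin 3]→L[ℝ] ℝ => A.compContinuousLinearMap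
      (mfderiv (𝓡 4) 𝓘(ℝ, R4) (extChartAt (𝓡 4) x) x)) hB))).trans ?_
  exact smul_zero _

lemma curvLow_antisymm (hD : IsLeviCivita g D) (hU : IsOpen U) {x : M} (hx : x ∈ U)
    (a b : Fin 4) : t.curvLow D b a x = -t.curvLow D a b x := by
  have h := curvature_antisymm ((eventually_chart hU hx).mono fun _ hz =>
    t.chartConn_antisymm hD hU hz.2) a b
  rw [curvLow, curvLow, curv_eq, curv_eq]
  exact congrArg (fun A : R4 [⋀^Fin 2]→L[ℝ] ℝ => A.compContinuousLinearMap
    (mfderiv (𝓡 4) 𝓘(ℝ, R4) (extChartAt (𝓡 4) x) x)) h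

lemma starθ_eq {z : M} (hz : z ∈ U) (a b c : Fin 4) :
    t.starθ a b c z = starTriple (fun d => t.coframe d z) a b c :=
  hodgeStar_wedge_coframe (t.dual z hz) (t.eq_sum hz) a b c

/-- `⋆⋆ = -1` on `2`-forms, with the sign absorbed as in the superpotential. -/
lemma star_neg_star {z : M} (hz : z ∈ U) (A : FormField M 2) :
    t.star (k := 2) (m := 2) rfl (-t.star (k := 2) (m := 2) rfl A) z = A z := by
  have h := hodgeStar_neg_hodgeStar_two (t.dual z hz) (t.eq_sum hz) (A z)
  have h1 : t.star (k := 2) (m := 2) rfl (-t.star (k := 2) (m := 2) rfl A) z =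
      hodgeStar (rfl : 2 + 2 = 4) (fun a => t.e a z) (t.vol z)
        (-(t.star (k := 2) (m := 2) rfl A z)) := rfl
  have h2 : t.star (k := 2) (m := 2) rfl A z =
      hodgeStar (rfl : 2 + 2 = 4) (fun a => t.e a z) (frameVol fun a => t.θ a z) (A z) := rfl
  have h3 : t.vol z = frameVol fun a => t.θ a z := rfl
  rw [h1, h2, h3]
  exact h

lemma star_superpotential {z : M} (hz : z ∈ U) (c : Fin 4) :
    t.star (k := 2) (m := 2) rfl (t.superpotential D c) z =
      (1 / 2 : ℝ) • ∑ a, ∑ b, wedge (t.connLow D a b z) (t.starθ a b c z) := by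
  unfold superpotential
  rw [t.star_neg_star hz]

lemma star_pseudoCurrent {z : M} (hz : z ∈ U) (c : Fin 4) :
      t.star (k := 1) (m := 3) rfl (t.pseudoCurrent D c) z =
        (-(1 / 2) : ℝ) • ∑ a, ∑ b, wedge (t.connLow D a b z)
          (∑ d, (wedge (t.conn D c d z) (t.starθ a b d z) +
            wedge (t.conn D b d z) (t.starθ a d c z))) :=
  hodgeStar_hodgeStar_three (t.dual z hz) (t.eq_sum hz) _

/-- `½ ℛ_ab ∧ ⋆(θ^a ∧ θ^b ∧ θ^c) = -⋆𝒢^c`. -/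
lemma half_curvLow_wedge_starθ (hD : IsLeviCivita g D) (hU : IsOpen U) {x : M} (hx : x ∈ U)
    (c : Fin 4) :
    (1 / 2 : ℝ) • ∑ a, ∑ b, wedge (t.curvLow D a b x) (t.starθ a b c x) =
        -t.star (k := 1) (m := 3) rfl (t.einsteinForm D c) x := by
  have h := einstein_form (t.dual x hx) (t.eq_sum hx) (fun a b => t.curvLow D a b x)
    (t.curvLow_antisymm hD hU hx) (t.sum_curvLow_wedge_coframe hD hU hx) c
  refine Eq.trans ?_ (h.trans ?_) <;> congr 1

lemma chartForm_star_superpotential (hU : IsOpen U) {x : M} (hx : x ∈ U)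
    (c : Fin 4) :
    chartForm x (t.star (k := 2) (m := 2) rfl (t.superpotential D c)) =ᶠ[𝓝 (extChartAt (𝓡 4) x x)]
      fun y => (1 / 2 : ℝ) • ∑ a, ∑ b, wedge (eta a • oneForm (t.chartConn D x a b y))
      (starTriple (fun d => oneForm (t.chartCoframe x d y)) a b c) := by
  filter_upwards [eventually_chart hU hx] with y hy
  rw [chartForm, t.star_superpotential hy.2]
  simp only [t.starθ_eq hy.2]
  exact superpotential_compContinuousLinearMap _ _ _ _

/-- The Leibniz rule for `d⋆𝒮^c`, with `dθ^a` eliminated by the first structure equation. -/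
lemma extD_star_superpotential (hD : IsLeviCivita g D) (hU : IsOpen U) {x : M} (hx : x ∈ U)
    (c : Fin 4) :
    extD (t.star (k := 2) (m := 2) rfl (t.superpotential D c)) x =
      (1 / 2 : ℝ) • ∑ a, ∑ b, eta a • (wedge (extD (t.conn D a b) x)
      (starTriple (fun d => t.coframe d x) a b c) + wedge (t.conn D a b x)
        (∑ d, starComp a b c d • ∑ m, wedge (t.conn D d m x) (t.coframe m x))) := by
  have hev := eventually_chart hU hx
  have h := extDeriv_superpotential
    (fun a => (t.contDiffAt_chartCoframe hU hev a).differentiableAt two_ne_zero)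
    (t.differentiableAt_chartConn hD hU hx)
    (fun a => (t.extDeriv_chartCoframe hD hU hx a).self_of_nhds) c
  rw [extD_eq, (t.chartForm_star_superpotential hU hx c).extDeriv_eq, h]
  refine (extDeriv_superpotential_compContinuousLinearMap _ _ _ _ _).trans ?_
  simp only [t.conn_eq, t.coframe_eq, extD_eq, chartForm_conn]

/-- `⋆𝒢^c = -d⋆𝒮^c - ⋆𝔱^c`. -/
lemma superpotential_identity (hD : IsLeviCivita g D) (hU : IsOpen U) {x : M} (hx : x ∈ U)
    (c : Fin 4) :
      t.star (k := 1) (m := 3) rfl (t.einsteinForm D c) x =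
        -extD (t.star (k := 2) (m := 2) rfl (t.superpotential D c)) x -
          t.star (k := 1) (m := 3) rfl (t.pseudoCurrent D c) x := by
  have h := t.half_curvLow_wedge_starθ hD hU hx c
  have halg := superpotential_algebra (fun d => t.coframe d x) (fun a b => t.conn D a b x)
    (fun a b => extD (t.conn D a b) x) (fun a b => by
      ext v
      exact t.connLow_antisymm hD hU hx a b _) c
  rw [t.star_pseudoCurrent hx, t.extD_star_superpotential hD hU hx]
  simp only [t.starθ_eq hx] at h ⊢
  ext v
  have hlin : ∀ A B C F : TangentSpace (𝓡 4) x [⋀^Fin 3]→L[ℝ] ℝ,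
      (1 / 2 : ℝ) • A = -F → A = B - C → F = -((1 / 2 : ℝ) • B) - (-(1 / 2) : ℝ) • C := by
    rintro A B C F h rfl
    rw [eq_neg_iff_add_eq_zero] at h
    rw [← neg_eq_iff_eq_neg.2 (eq_neg_of_add_eq_zero_left h), smul_sub]
    module
  exact congrArg (fun A : TangentSpace (𝓡 4) x [⋀^Fin 3]→L[ℝ] ℝ => A v)
    (hlin _ _ _ _ h halg)

lemma einsteinEqAt_iff (T : TwoTensor M) {x : M} (hx : x ∈ U) :
    t.EinsteinEqAt D T x ↔ ∀ a, t.einsteinForm D a x = t.energyForm T a x := by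
  have heta : ∀ a, eta a * eta a = 1 := fun a => by unfold eta; split_ifs <;> norm_num
  have hG : ∀ a b, t.einsteinForm D a x ![t.e b x] =
      eta a * (t.ricci D a b x - 1 / 2 * (if a = b then eta a else 0) * t.scalar D x) := by
    intro a b
    have : t.einsteinForm D a x ![t.e b x] = (∑ d, (eta a * t.ricci D a d x) *
        t.θ d x (t.e b x)) - 1 / 2 * t.scalar D x * t.θ a x (t.e b x) := by
      simp only [einsteinForm, ricciForm, coframe]
      rw [ContinuousAlternatingMap.sub_apply, ContinuousAlternatingMap.sum_apply]
      rfl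
    rw [this]
    simp only [t.dual x hx, mul_ite, mul_one, mul_zero, Finset.sum_ite_eq', Finset.mem_univ,
      if_true]
    split_ifs
    · linear_combination (1 / 2 * t.scalar D x) * heta a
    · ring
  have hT : ∀ a b, t.energyForm T a x ![t.e b x] = eta a * t.comp T a b x := by
    intro a b
    have : t.energyForm T a x ![t.e b x] = ∑ d, (eta a * t.comp T a d x) *
        t.θ d x (t.e b x) := by
      simp only [energyForm, coframe]
      rw [ContinuousAlternatingMap.sum_apply]
      rfl
    rw [this]
    simp only [t.dual x hx, mul_ite, mul_one, mul_zero, Finset.sum_ite_eq',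
      Finset.mem_univ, if_true]
  have hne : ∀ a, eta a ≠ 0 := fun a h => by simpa [h] using heta a
  constructor
  · intro h a
    refine form_ext_one (t.eq_sum hx) fun b => ?_
    exact (hG a b).trans ((congrArg (eta a * ·) (h a b)).trans (hT a b).symm)
  · intro h a b
    refine mul_left_cancel₀ (hne a) ?_
    rw [← hG, ← hT, h]

lemma star_one_injective {x : M} (hx : x ∈ U) {A B : FormField M 1}
    (h : t.star (k := 1) (m := 3) rfl A x = t.star (k := 1) (m := 3) rfl B x) : A x = B x :=
  hodgeStar_one_injective (t.dual x hx) (t.eq_sum hx) h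

end OrthonormalTetrad

end Spacetime

end

theorem mainTheorem10 {M : Type*} [TopologicalSpace M]
    [ChartedSpace (EuclideanSpace ℝ (Fin 4)) M] [IsManifold (𝓡 4) ∞ M]
    (g : LorentzianMetric M) (D : LinearConnection M) (hD : IsLeviCivita g D)
    (U : Set M) (hU : IsOpen U) (t : OrthonormalTetrad g U) :
    -- explicit superpotentials and pseudo-currents
    (∀ x ∈ U, ∀ c : Fin 4,
      t.star (k := 2) (m := 2) rfl (t.superpotential D c) x =
        (1 / 2 : ℝ) • ∑ a, ∑ b, wedge (t.connLow D a b x) (t.starθ a b c x)) ∧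
    (∀ x ∈ U, ∀ c : Fin 4,
      t.star (k := 1) (m := 3) rfl (t.pseudoCurrent D c) x =
        (-(1 / 2) : ℝ) • ∑ a, ∑ b, wedge (t.connLow D a b x)
          (∑ d, (wedge (t.conn D c d x) (t.starθ a b d x) +
            wedge (t.conn D b d x) (t.starθ a d c x)))) ∧
    -- the Einstein forms in terms of the curvature forms
    (∀ x ∈ U, ∀ c : Fin 4,
      (1 / 2 : ℝ) • ∑ a, ∑ b, wedge (t.curvLow D a b x) (t.starθ a b c x) =
        -t.star (k := 1) (m := 3) rfl (t.einsteinForm D c) x) ∧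
    -- the superpotential identity
    (∀ x ∈ U, ∀ c : Fin 4,
      t.star (k := 1) (m := 3) rfl (t.einsteinForm D c) x =
        -extD (t.star (k := 2) (m := 2) rfl (t.superpotential D c)) x -
          t.star (k := 1) (m := 3) rfl (t.pseudoCurrent D c) x) ∧
    -- the superpotential form of Einstein's equations
    (∀ (T : TwoTensor M), ∀ x ∈ U,
      t.EinsteinEqAt D T x ↔ ∀ a : Fin 4,
        -extD (t.star (k := 2) (m := 2) rfl (t.superpotential D a)) x =
          t.star (k := 1) (m := 3) rfl (t.energyForm T a) x +
            t.star (k := 1) (m := 3) rfl (t.pseudoCurrent D a) x) := by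
  refine ⟨fun x hx c => t.star_superpotential hx c, fun x hx c => t.star_pseudoCurrent hx c,
    fun x hx c => t.half_curvLow_wedge_starθ hD hU hx c,
    fun x hx c => t.superpotential_identity hD hU hx c, fun T x hx => ?_⟩
  rw [t.einsteinEqAt_iff T hx]
  refine forall_congr' fun a => ?_
  have key := t.superpotential_identity hD hU hx a
  constructor
  · intro h
    have h' : t.star (k := 1) (m := 3) rfl (t.energyForm T a) x =
        t.star (k := 1) (m := 3) rfl (t.einsteinForm D a) x :=
      congrArg (hodgeStar _ _ _) h.symm
    rw [h', key, sub_add_cancel]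
  · intro h
    refine t.star_one_injective hx ?_
    rw [key, h, add_sub_cancel_right]
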